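/- Let $\mathbb F$ be a field, $n\ge 1$, and consider $n$-parameter persistence modules over $\mathbb F$, i.e. functors $M$ from the poset $\mathbb R^n$ to $\mathbb F$-vector spaces. A \emph{cube} is a product of $n$ (possibly unbounded, open or closed) intervals of $\mathbb R$. $M$ is \emph{cubically encoded} if $M\cong e^*M'$ for a monotone map $e$ from $\mathbb R^n$ to a finite poset $P$ whose fibres are finite unions of cubes and a pointwise finite-dimensional $P$-module $M'$. Let $\mathcal C_n$ be the (abelian) full subcategory of cubically encoded modules. A \emph{face} of the positive cone $\mathbb R^n_{\ge 0}$ is the cone $\rho$ spanned by a subset of the standard basis vectors. The localization $M_\rho$ has $(M_\rho)_x=\varinjlim_{s\in\rho}M_{x+s}$. For a face $\tau$ of positive dimension the \emph{$0$-th local cohomology} is \[H^0_\tau(M)=\ker\Big(M\to\prod_{0\neq\rho\subseteq\tau}M_\rho\Big),\] the product running over the nonzero faces $\rho$ contained in $\tau$; it is a functor $H^0_\tau:\mathcal C_n\to\mathcal C_n$. An \emph{amplitude} on an abelian category is a function $\alpha$ from its objects to $[0,\infty]$ with $\alpha(0)=0$ and, for every short exact sequence $0\to A\to B\to C\to 0$,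 $\alpha(A)\le\alpha(B)$, $\alpha(C)\le\alpha(B)$ and $\alpha(B)\le\alpha(A)+\alpha(C)$. Its \emph{path metric} $d_\alpha(A,B)$ is the infimum, over all zigzags of morphisms $A\leftarrow C_1\to\cdots\leftarrow C_k\to B$, of the sum over the morphisms $\gamma$ in the zigzag of $\alpha(\ker\gamma)+\alpha(\operatorname{coker}\gamma)$. For a measure $\mu$ on the Lebesgue $\sigma$-algebra of $\mathbb R^n$ and $1\le p<\infty$, the \emph{$L^p$ Hilbert amplitude} on $\mathcal C_n$ is $\alpha_{\mu,p}(M)=\big(\int_{\mathbb R^n}(\dim M_x)^p\,d\mu(x)\big)^{1/p}$. For $v\in\mathbb R^n_{\ge0}$ and $\varepsilon>0$, write $M^{+\varepsilon}_x=M_{x+\varepsilon v}$; an \emph{$\varepsilon$-interleaving} of $M,N$ along $v$ is a pair of morphisms $\varphi:M\to N^{+\varepsilon}$, $\psi:N\to M^{+\varepsilon}$ whose composites $M_x\to N_{x+\varepsilon v}\to M_{x+2\varepsilon v}$ and $N_x\to M_{x+\varepsilon v}\to N_{x+2\varepsilon v}$ are the structure maps for all $x\in\mathbb R^n$; the \emph{interleaving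 distance} $d_I^v(M,N)\in[0,\infty]$ is the infimum of the $\varepsilon>0$ for which an $\varepsilon$-interleaving exists. \textbf{Proposition.} Let $\tau$ be a face of the positive cone of $\mathbb R^n$ of positive dimension. Then: \begin{enumerate} \item for every amplitude $\alpha$ on $\mathcal C_n$, the functor $H^0_\tau$ is amplitude-bounding with constant $1$, i.e. it is additive and $\alpha(H^0_\tau(M))\le\alpha(M)$ for all $M$; \item $d_I^v(H^0_\tau M,H^0_\tau N)\le d_I^v(M,N)$ for all $M,N$ in $\mathcal C_n$ and every $v\in\mathbb R^n_{\ge0}$; \item for every finite nonzero measure $\mu$ on the Lebesgue $\sigma$-algebra of $\mathbb R^n$ and every $1\le p<\infty$, the map $M\mapsto H^0_\tau M$ on the objects of $\mathcal C_n$ is not continuous with respect to $d_{\alpha_{\mu,p}}$ (on both source and target); \item if $\mu$ is the Lebesgue measure and $1\le p<\infty$, then $d_{\alpha_{\mu,p}}(H^0_\tau M,H^0_\tau N)\le d_{\alpha_{\mu,p}}(M,N)$ for all $M,N$ in $\mathcal C_n$. \end{enumerate} -/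

import Mathlib

open CategoryTheory CategoryTheory.Limits MeasureTheory
open scoped ENNReal NNReal

universe u

/-- The poset `ℝⁿ` with the product order. It is a copy of `Fin n → ℝ` whose only categorical
structure is that of a poset. -/
def ParamSpace (n : ℕ) : Type := Fin n → ℝ

namespace ParamSpace

variable {n : ℕ}

noncomputable instance : Lattice (ParamSpace n) := inferInstanceAs (Lattice (Fin n → ℝ))

noncomputable instance : AddCommGroup (ParamSpace n) :=
  inferInstanceAs (AddCommGroup (Fin n → ℝ))

noncomputable instance : Module ℝ (ParamSpace n) := inferInstanceAs (Module ℝ (Fin n → ℝ))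

instance : IsOrderedAddMonoid (ParamSpace n) :=
  inferInstanceAs (IsOrderedAddMonoid (Fin n → ℝ))

/-- The coordinates of a point of `ℝⁿ`. -/
def coord (x : ParamSpace n) : Fin n → ℝ := x

theorem le_iff {x y : ParamSpace n} : x ≤ y ↔ ∀ i, x.coord i ≤ y.coord i := Iff.rfl

theorem smul_nonneg' {v : ParamSpace n} (hv : 0 ≤ v) (ε : ℝ≥0) : 0 ≤ (ε : ℝ) • v :=
  fun i => mul_nonneg ε.2 (hv i)

end ParamSpace

/-- `n`-parameter persistence modules over `F`: functors from the poset `ℝⁿ` to `F`-vector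
spaces. -/
abbrev PersMod (F : Type u) [Field F] (n : ℕ) := ParamSpace n ⥤ ModuleCat.{u} F

/-- A cube: a product of (possibly unbounded, open, half-open or closed) intervals of `ℝ`. -/
def IsCube {n : ℕ} (C : Set (ParamSpace n)) : Prop :=
  ∃ I : Fin n → Set ℝ, (∀ i, (I i).OrdConnected) ∧ C = {x | ∀ i, x.coord i ∈ I i}

/-- The members of the algebra of cubes: finite unions of cubes. -/
def IsCubical {n : ℕ} (S : Set (ParamSpace n)) : Prop :=
  ∃ 𝒞 : Set (Set (ParamSpace n)), 𝒞.Finite ∧ (∀ C ∈ 𝒞, IsCube C) ∧ S = ⋃₀ 𝒞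

/-- A persistence module is cubically encoded if it is isomorphic to the pullback, along a
monotone map `e` to a finite poset `P` whose fibres are finite unions of cubes, of a pointwise
finite-dimensional `P`-module. -/
def cubicallyEncoded (F : Type u) [Field F] (n : ℕ) : ObjectProperty (PersMod F n) := fun M =>
  ∃ (P : Type) (_ : PartialOrder P) (_ : Finite P) (e : ParamSpace n →o P)
    (M' : P ⥤ ModuleCat.{u} F),
    (∀ p, FiniteDimensional F (M'.obj p)) ∧ (∀ p, IsCubical (e ⁻¹' {p})) ∧
      Nonempty (M ≅ e.monotone.functor ⋙ M')

section Grid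

/-! Cubical encodings in terms of grids of thresholds. -/

variable {F : Type u} [Field F] {n : ℕ}

/-- `x` and `y` lie in the same cell of the grid whose thresholds are the elements of `T`. -/
def SameCell (T : Finset ℝ) (x y : ParamSpace n) : Prop :=
  ∀ i, ∀ t ∈ T, (x.coord i < t ↔ y.coord i < t) ∧ (x.coord i ≤ t ↔ y.coord i ≤ t)

theorem SameCell.mono {T T' : Finset ℝ} (h : T ⊆ T') {x y : ParamSpace n}
    (hxy : SameCell T' x y) : SameCell T x y :=
  fun i t ht => hxy i t (h ht)

theorem SameCell.symm {T : Finset ℝ} {x y : ParamSpace n} (h : SameCell T x y) :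
    SameCell T y x :=
  fun i t ht => ⟨(h i t ht).1.symm, (h i t ht).2.symm⟩

theorem SameCell.inf {T : Finset ℝ} {x y : ParamSpace n} (h : SameCell T x y) :
    SameCell T (x ⊓ y) x := by
  intro i t ht
  obtain ⟨h1, h2⟩ := h i t ht
  have : (x ⊓ y).coord i = min (x.coord i) (y.coord i) := rfl
  rw [this]
  constructor
  · rw [min_lt_iff]; tauto
  · rw [min_le_iff]; tauto

/-- The module is pointwise finite-dimensional and constant on the cells of a finite grid. -/
def GridConstant (M : PersMod F n) : Prop :=
  (∀ x, FiniteDimensional F (M.obj x)) ∧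
    ∃ T : Finset ℝ, ∀ (x y : ParamSpace n) (h : x ≤ y), SameCell T x y →
      IsIso (M.map (homOfLE h))

theorem exists_thresholds_interval (I : Set ℝ) (hI : I.OrdConnected) :
    ∃ T : Finset ℝ, ∀ x y : ℝ, (∀ t ∈ T, (x < t ↔ y < t) ∧ (x ≤ t ↔ y ≤ t)) → x ∈ I → y ∈ I := by
  classical
  refine ⟨{sInf I, sSup I}, fun x y h hx => ?_⟩
  by_contra hy
  have h1 := h (sInf I) (by simp)
  have h2 := h (sSup I) (by simp)
  rcases lt_trichotomy y x with hlt | heq | hlt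
  · have hb : ∀ z ∈ I, y ≤ z := fun z hz => by
      by_contra hc
      exact hy (hI.out hz hx ⟨(not_le.mp hc).le, hlt.le⟩)
    have h3 : y ≤ sInf I := le_csInf ⟨x, hx⟩ hb
    have h4 : sInf I ≤ x := csInf_le ⟨y, hb⟩ hx
    have h5 := h1.2.2 h3
    have h6 : ¬ x < sInf I := not_lt.mpr h4
    have h7 : ¬ y < sInf I := fun h => h6 (h1.1.2 h)
    linarith
  · exact hy (heq ▸ hx)
  · have hb : ∀ z ∈ I, z ≤ y := fun z hz => by
      by_contra hc
      exact hy (hI.out hx hz ⟨hlt.le, (not_le.mp hc).le⟩)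
    have h3 : sSup I ≤ y := csSup_le ⟨x, hx⟩ hb
    have h4 : x ≤ sSup I := le_csSup ⟨y, hb⟩ hx
    have h5 := h2.2.1 h4
    have h6 : ¬ y < sSup I := not_lt.mpr h3
    have h7 : ¬ x < sSup I := fun h => h6 (h2.1.1 h)
    linarith

theorem exists_thresholds_cubical (S : Set (ParamSpace n)) (hS : IsCubical S) :
    ∃ T : Finset ℝ, ∀ x y : ParamSpace n, SameCell T x y → x ∈ S → y ∈ S := by
  classical
  obtain ⟨𝒞, hfin, hcube, rfl⟩ := hS
  have key : ∀ C : Set (ParamSpace n), ∃ T : Finset ℝ, C ∈ 𝒞 →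
      ∀ x y : ParamSpace n, SameCell T x y → x ∈ C → y ∈ C := by
    intro C
    by_cases hC : C ∈ 𝒞
    · obtain ⟨I, hI, rfl⟩ := hcube C hC
      choose T hT using fun i => exists_thresholds_interval (I i) (hI i)
      refine ⟨Finset.univ.biUnion T, fun _ x y h hx i => ?_⟩
      exact hT i (x i) (y i)
        (fun t ht => h i t (Finset.mem_biUnion.2 ⟨i, Finset.mem_univ _, ht⟩)) (hx i)
    · exact ⟨∅, fun h => absurd h hC⟩
  choose T hT using key
  refine ⟨hfin.toFinset.biUnion T, ?_⟩
  rintro x y h ⟨C, hC, hx⟩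
  refine ⟨C, hC, hT C hC x y (h.mono ?_) hx⟩
  exact Finset.subset_biUnion_of_mem T (hfin.mem_toFinset.2 hC)

theorem GridConstant.of_cubicallyEncoded {M : PersMod F n} (hM : cubicallyEncoded F n M) :
    GridConstant M := by
  classical
  obtain ⟨P, _, _, e, M', hfd, hfib, ⟨η⟩⟩ := hM
  have := Fintype.ofFinite P
  choose T hT using fun p => exists_thresholds_cubical (e ⁻¹' {p}) (hfib p)
  refine ⟨fun x => ?_, Finset.univ.biUnion T, fun x y h hxy => ?_⟩
  · have : FiniteDimensional F ((e.monotone.functor ⋙ M').obj x) := hfd (e x)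
    exact Module.Finite.equiv (η.app x).toLinearEquiv.symm
  · have hexy : e y = e x :=
      hT (e x) x y (hxy.mono (Finset.subset_biUnion_of_mem T (Finset.mem_univ _))) rfl
    have h1 : IsIso (e.monotone.functor.map (homOfLE h)) :=
      ⟨homOfLE hexy.le, Subsingleton.elim _ _, Subsingleton.elim _ _⟩
    have h2 : IsIso ((e.monotone.functor ⋙ M').map (homOfLE h)) := by
      dsimp only [Functor.comp_map]
      infer_instance
    have h3 : M.map (homOfLE h) =
        η.hom.app x ≫ (e.monotone.functor ⋙ M').map (homOfLE h) ≫ η.inv.app y := by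
      rw [η.inv.naturality, Iso.hom_inv_id_app_assoc]
    rw [h3]
    infer_instance

/-- The cell of a real number in the grid with thresholds `T`. -/
noncomputable def cellMap (T : Finset ℝ) (r : ℝ) : Finset ℝ × Finset ℝ :=
  (T.filter (· ≤ r), T.filter (· < r))

theorem cellMap_mono (T : Finset ℝ) : Monotone (cellMap T) := by
  intro r s h
  refine ⟨fun t ht => ?_, fun t ht => ?_⟩
  · simp only [cellMap, Finset.mem_filter] at ht ⊢
    exact ⟨ht.1, ht.2.trans h⟩
  · simp only [cellMap, Finset.mem_filter] at ht ⊢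
    exact ⟨ht.1, ht.2.trans_le h⟩

theorem finite_range_cellMap (T : Finset ℝ) : (Set.range (cellMap T)).Finite := by
  refine (Finset.finite_toSet (T.powerset ×ˢ T.powerset)).subset ?_
  rintro _ ⟨r, rfl⟩
  simp only [cellMap, Finset.coe_product, Set.mem_prod, Finset.mem_coe, Finset.mem_powerset]
  exact ⟨Finset.filter_subset _ _, Finset.filter_subset _ _⟩

theorem cellMap_eq {T : Finset ℝ} {r s : ℝ} (h : cellMap T r = cellMap T s) :
    ∀ t ∈ T, (r < t ↔ s < t) ∧ (r ≤ t ↔ s ≤ t) := by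
  intro t ht
  have h1 := congrArg (fun p => t ∈ p.1) h
  have h2 := congrArg (fun p => t ∈ p.2) h
  simp only [cellMap, Finset.mem_filter, ht, true_and, eq_iff_iff] at h1 h2
  exact ⟨by rw [← not_le, h1, not_le], by rw [← not_lt, h2, not_lt]⟩

/-- The finite poset of cells of `ℝⁿ` in the grid with thresholds `T`. -/
def CellPoset (T : Finset ℝ) (n : ℕ) : Type := Fin n → Set.range (cellMap T)

instance (T : Finset ℝ) (n : ℕ) : PartialOrder (CellPoset T n) :=
  inferInstanceAs (PartialOrder (Fin n → Set.range (cellMap T)))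

instance (T : Finset ℝ) (n : ℕ) : Finite (CellPoset T n) :=
  have : Finite (Set.range (cellMap T)) := finite_range_cellMap T
  inferInstanceAs (Finite (Fin n → Set.range (cellMap T)))

theorem GridConstant.cubicallyEncoded {M : PersMod F n} (hM : GridConstant M) :
    cubicallyEncoded F n M := by
  classical
  obtain ⟨hfd, T, hT⟩ := hM
  let P := CellPoset T n
  let e : ParamSpace n →o P :=
    ⟨fun x i => ⟨cellMap T (x i), x i, rfl⟩, fun x y h i => cellMap_mono T (h i)⟩
  choose σ hσ using fun p : Set.range (cellMap T) => p.2
  have hσm : Monotone σ := by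
    intro p q hpq
    by_contra hc
    have h1 : cellMap T (σ q) ≤ cellMap T (σ p) := cellMap_mono T (not_le.mp hc).le
    rw [hσ, hσ] at h1
    have : p = q := le_antisymm hpq h1
    exact hc (this ▸ le_rfl)
  let s : P →o ParamSpace n := ⟨fun p i => σ (p i), fun p q h i => hσm (h i)⟩
  have hse : ∀ x : ParamSpace n, SameCell T x (s (e x)) := fun x i =>
    cellMap_eq (hσ (e x i)).symm
  refine ⟨P, inferInstance, inferInstance, e, s.monotone.functor ⋙ M, fun p => hfd _, ?_, ?_⟩
  · intro p
    refine ⟨{e ⁻¹' {p}}, Set.finite_singleton _, ?_, by simp⟩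
    rintro C rfl
    refine ⟨fun i => {r | cellMap T r = p i}, fun i => ⟨?_⟩, ?_⟩
    · intro a ha b hb c hc
      refine le_antisymm ?_ ?_
      · exact (cellMap_mono T hc.2).trans hb.le
      · exact ha.ge.trans (cellMap_mono T hc.1)
    · ext x
      simp only [Set.mem_preimage, Set.mem_singleton_iff, Set.mem_ofPred_eq]
      exact ⟨fun h i => by rw [← h]; rfl, fun h => funext fun i => Subtype.ext (h i)⟩
  · have i1 : ∀ x, IsIso (M.map (homOfLE (inf_le_left : x ⊓ s (e x) ≤ x))) := fun x =>
      hT _ _ _ (hse x).inf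
    have i2 : ∀ x, IsIso (M.map (homOfLE (inf_le_right : x ⊓ s (e x) ≤ s (e x)))) := fun x =>
      hT _ _ _ (by rw [inf_comm]; exact (hse x).symm.inf)
    refine ⟨NatIso.ofComponents (fun x =>
      (@asIso _ _ _ _ _ (i1 x)).symm ≪≫ @asIso _ _ _ _ _ (i2 x)) ?_⟩
    intro x y f
    have hle : x ⊓ s (e x) ≤ y ⊓ s (e y) :=
      inf_le_inf (leOfHom f) (s.monotone (e.monotone (leOfHom f)))
    have e1 : M.map (homOfLE (inf_le_left : x ⊓ s (e x) ≤ x)) ≫ M.map f =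
        M.map (homOfLE hle) ≫ M.map (homOfLE (inf_le_left : y ⊓ s (e y) ≤ y)) := by
      rw [← M.map_comp, ← M.map_comp]; rfl
    have e2 : M.map (homOfLE (inf_le_right : x ⊓ s (e x) ≤ s (e x))) ≫
        M.map (homOfLE (s.monotone (e.monotone (leOfHom f)))) =
        M.map (homOfLE hle) ≫ M.map (homOfLE (inf_le_right : y ⊓ s (e y) ≤ s (e y))) := by
      rw [← M.map_comp, ← M.map_comp]; rfl
    have e4 := i1 x
    have e5 := i1 y
    change M.map f ≫ inv (M.map (homOfLE (inf_le_left : y ⊓ s (e y) ≤ y))) ≫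
        M.map (homOfLE (inf_le_right : y ⊓ s (e y) ≤ s (e y))) =
      (inv (M.map (homOfLE (inf_le_left : x ⊓ s (e x) ≤ x))) ≫
        M.map (homOfLE (inf_le_right : x ⊓ s (e x) ≤ s (e x)))) ≫
        M.map (homOfLE (s.monotone (e.monotone (leOfHom f))))
    rw [Category.assoc, e2,
      ← cancel_epi (M.map (homOfLE (inf_le_left : x ⊓ s (e x) ≤ x))), ← Category.assoc, e1,
      Category.assoc, IsIso.hom_inv_id_assoc, IsIso.hom_inv_id_assoc]

theorem cubicallyEncoded_iff_gridConstant (M : PersMod F n) :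
    cubicallyEncoded F n M ↔ GridConstant M :=
  ⟨GridConstant.of_cubicallyEncoded, GridConstant.cubicallyEncoded⟩

theorem GridConstant.kernel {S : ShortComplex (PersMod F n)} (hS : S.Exact) [Mono S.f]
    (h₂ : GridConstant S.X₂) (h₃ : GridConstant S.X₃) : GridConstant S.X₁ := by
  classical
  obtain ⟨hfd, T₂, hT₂⟩ := h₂
  obtain ⟨-, T₃, hT₃⟩ := h₃
  have hinj : ∀ x, Function.Injective (S.f.app x) := fun x =>
    (ModuleCat.mono_iff_injective _).1 inferInstance
  have hex : ∀ x, Function.Exact (S.f.app x) (S.g.app x) := fun x =>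
    (ShortComplex.ShortExact.moduleCat_exact_iff_function_exact _).1
      (hS.map ((evaluation _ (ModuleCat.{u} F)).obj x))
  refine ⟨fun x => ?_, T₂ ∪ T₃, fun x y hxy hc => ?_⟩
  · have := hfd x
    exact Module.Finite.of_injective (S.f.app x).hom (hinj x)
  · have i2 := hT₂ x y hxy (hc.mono Finset.subset_union_left)
    have i3 := hT₃ x y hxy (hc.mono Finset.subset_union_right)
    rw [ConcreteCategory.isIso_iff_bijective] at i2 i3 ⊢
    have nf : ∀ a, S.f.app y (S.X₁.map (homOfLE hxy) a) = S.X₂.map (homOfLE hxy) (S.f.app x a) :=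
      fun a => NatTrans.naturality_apply S.f (homOfLE hxy) a
    have ng : ∀ a, S.g.app y (S.X₂.map (homOfLE hxy) a) = S.X₃.map (homOfLE hxy) (S.g.app x a) :=
      fun a => NatTrans.naturality_apply S.g (homOfLE hxy) a
    constructor
    · intro a b hab
      apply hinj x
      apply i2.1
      rw [← nf, ← nf, hab]
    · intro b
      obtain ⟨c, hc⟩ := i2.2 (S.f.app y b)
      have h0 : S.g.app x c = 0 := by
        apply i3.1
        rw [← ng, hc, map_zero]
        exact (hex y _).2 ⟨b, rfl⟩
      obtain ⟨a, ha⟩ := (hex x c).1 h0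
      refine ⟨a, hinj y ?_⟩
      rw [nf, ha, hc]

theorem GridConstant.cokernel {S : ShortComplex (PersMod F n)} (hS : S.Exact) [Epi S.g]
    (h₁ : GridConstant S.X₁) (h₂ : GridConstant S.X₂) : GridConstant S.X₃ := by
  classical
  obtain ⟨-, T₁, hT₁⟩ := h₁
  obtain ⟨hfd, T₂, hT₂⟩ := h₂
  have hsurj : ∀ x, Function.Surjective (S.g.app x) := fun x =>
    (ModuleCat.epi_iff_surjective _).1 inferInstance
  have hex : ∀ x, Function.Exact (S.f.app x) (S.g.app x) := fun x =>
    (ShortComplex.ShortExact.moduleCat_exact_iff_function_exact _).1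
      (hS.map ((evaluation _ (ModuleCat.{u} F)).obj x))
  refine ⟨fun x => ?_, T₁ ∪ T₂, fun x y hxy hc => ?_⟩
  · have := hfd x
    exact Module.Finite.of_surjective (S.g.app x).hom (hsurj x)
  · have i1 := hT₁ x y hxy (hc.mono Finset.subset_union_left)
    have i2 := hT₂ x y hxy (hc.mono Finset.subset_union_right)
    rw [ConcreteCategory.isIso_iff_bijective] at i1 i2 ⊢
    have nf : ∀ a, S.f.app y (S.X₁.map (homOfLE hxy) a) = S.X₂.map (homOfLE hxy) (S.f.app x a) :=
      fun a => NatTrans.naturality_apply S.f (homOfLE hxy) a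
    have ng : ∀ a, S.g.app y (S.X₂.map (homOfLE hxy) a) = S.X₃.map (homOfLE hxy) (S.g.app x a) :=
      fun a => NatTrans.naturality_apply S.g (homOfLE hxy) a
    constructor
    · rw [injective_iff_map_eq_zero]
      intro c hc
      obtain ⟨b, rfl⟩ := hsurj x c
      rw [← ng] at hc
      obtain ⟨a', ha'⟩ := (hex y _).1 hc
      obtain ⟨a, rfl⟩ := i1.2 a'
      rw [nf] at ha'
      rw [← i2.1 ha']
      exact (hex x _).2 ⟨a, rfl⟩
    · intro c
      obtain ⟨b', rfl⟩ := hsurj y c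
      obtain ⟨b, rfl⟩ := i2.2 b'
      exact ⟨S.g.app x b, (ng b).symm⟩

instance : (cubicallyEncoded F n).IsClosedUnderKernels where
  kernels_le := by
    rintro _ ⟨f, k, hk, hf⟩
    have : Mono k.ι := Fork.IsLimit.mono hk
    refine (cubicallyEncoded_iff_gridConstant _).2 (GridConstant.kernel
      (S := ShortComplex.mk k.ι f k.condition) ?_
      ((cubicallyEncoded_iff_gridConstant _).1 hf.1) ((cubicallyEncoded_iff_gridConstant _).1 hf.2))
    exact ShortComplex.exact_of_f_is_kernel _ (hk.ofIsoLimit (Fork.ext (Iso.refl _)))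

instance : (cubicallyEncoded F n).IsClosedUnderCokernels where
  cokernels_le := by
    rintro _ ⟨f, k, hk, hf⟩
    have : Epi k.π := Cofork.IsColimit.epi hk
    refine (cubicallyEncoded_iff_gridConstant _).2 (GridConstant.cokernel
      (S := ShortComplex.mk f k.π k.condition) ?_
      ((cubicallyEncoded_iff_gridConstant _).1 hf.1) ((cubicallyEncoded_iff_gridConstant _).1 hf.2))
    exact ShortComplex.exact_of_g_is_cokernel _ (hk.ofIsoColimit (Cofork.ext (Iso.refl _)))

instance : (cubicallyEncoded F n).ContainsZero where
  exists_zero := by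
    obtain ⟨Z, hZ⟩ := HasZeroObject.zero (C := PersMod F n)
    refine ⟨Z, hZ, (cubicallyEncoded_iff_gridConstant _).2 ⟨fun x => ?_, ∅, fun x y h _ => ?_⟩⟩
    · have : Subsingleton (Z.obj x) :=
        ModuleCat.subsingleton_of_isZero ((Functor.isZero_iff _).1 hZ x)
      infer_instance
    · exact ⟨0, ((Functor.isZero_iff _).1 hZ x).eq_of_src _ _,
        ((Functor.isZero_iff _).1 hZ y).eq_of_src _ _⟩

instance : (cubicallyEncoded F n).IsClosedUnderFiniteProducts where
  isClosedUnderLimitsOfShape J _ := ⟨by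
    rintro X ⟨p⟩
    classical
    have := Fintype.ofFinite J
    have hg := fun j : J => (cubicallyEncoded_iff_gridConstant _).1 (p.prop_diag_obj ⟨j⟩)
    choose hfd T hT using hg
    have hlim := fun x => isLimitOfPreserves ((evaluation _ (ModuleCat.{u} F)).obj x) p.isLimit
    refine (cubicallyEncoded_iff_gridConstant _).2
      ⟨fun x => ?_, Finset.univ.biUnion T, fun x y hxy hc => ?_⟩
    · let φ : X.obj x →ₗ[F] ∀ j : J, (p.diag.obj ⟨j⟩).obj x :=
        LinearMap.pi fun j => ((p.π.app ⟨j⟩).app x).hom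
      refine Module.Finite.of_injective φ fun a b hab => ?_
      refine Concrete.isLimit_ext _ (hlim x) a b ?_
      rintro ⟨j⟩
      exact congrFun hab j
    · have i : ∀ j : Discrete J, IsIso ((p.diag.obj j).map (homOfLE hxy)) := fun ⟨j⟩ =>
        hT j x y hxy (hc.mono (Finset.subset_biUnion_of_mem T (Finset.mem_univ j)))
      let α : p.diag ⋙ (evaluation _ (ModuleCat.{u} F)).obj x ⟶
          p.diag ⋙ (evaluation _ (ModuleCat.{u} F)).obj y :=
        Functor.whiskerLeft p.diag ((evaluation _ (ModuleCat.{u} F)).map (homOfLE hxy))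
      have : ∀ j, IsIso (α.app j) := i
      have hα : IsIso α := NatIso.isIso_of_isIso_app α
      have h1 : X.map (homOfLE hxy) =
          (IsLimit.conePointsIsoOfNatIso (hlim x) (hlim y) (asIso α)).hom := by
        refine (hlim y).hom_ext fun j => ?_
        rw [IsLimit.conePointsIsoOfNatIso_hom_comp]
        exact ((p.π.app j).naturality (homOfLE hxy))
      rw [h1]
      infer_instance⟩

/-- The category of cubically encoded persistence modules over `ℝⁿ`, a full abelian subcategory
of all persistence modules. -/
abbrev CubMod (F : Type u) [Field F] (n : ℕ) := (cubicallyEncoded F n).FullSubcategory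

end Grid

section LocalCohomology

variable {n : ℕ}

/-- The translations `x ↦ x + s` of the poset `ℝⁿ`, functorially in `s`. -/
noncomputable def translation (n : ℕ) : ParamSpace n ⥤ ParamSpace n ⥤ ParamSpace n where
  obj s := Monotone.functor (f := fun x => x + s) fun _ _ h => add_le_add_left h s
  map f := { app := fun x => homOfLE (add_le_add_right (leOfHom f) x) }

/-- The face of the positive cone of `ℝⁿ` spanned by the standard basis vectors `e_j`, `j ∈ R`. -/
def face (R : Finset (Fin n)) : Set (ParamSpace n) :=
  {x | 0 ≤ x ∧ ∀ i, i ∉ R → x.coord i = 0}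

/-- The origin, as an element of a face. -/
noncomputable def faceZero (R : Finset (Fin n)) : face R := ⟨0, le_rfl, fun _ _ => rfl⟩

/-- The inclusion of a face into `ℝⁿ`, as a functor of posets. -/
noncomputable def faceInclusion (R : Finset (Fin n)) : face R ⥤ ParamSpace n :=
  Monotone.functor (f := Subtype.val) fun _ _ h => h

variable (F : Type u) [Field F]

/-- Localization along the face spanned by `R`: the value of the localization of `M` at `x` is the
colimit of `M (x + s)` over `s` in the face. -/
noncomputable def localization (R : Finset (Fin n)) : PersMod F n ⥤ PersMod F n :=
  Functor.whiskeringRight (ParamSpace n) (ParamSpace n) (ModuleCat.{u} F) ⋙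
    (Functor.whiskeringLeft (face R) _ _).obj (faceInclusion R ⋙ translation n) ⋙ colim

/-- The canonical morphism from a module to its translate by `0`. -/
noncomputable def toTranslateZero (M : PersMod F n) : M ⟶ (translation n).obj 0 ⋙ M where
  app x := M.map (homOfLE (add_zero x).ge)
  naturality _ _ f := by
    dsimp only [Functor.comp_map]
    rw [← M.map_comp, ← M.map_comp]
    rfl

/-- The canonical morphism from a module to its localization along a face. -/
noncomputable def toLocalization (R : Finset (Fin n)) : 𝟭 (PersMod F n) ⟶ localization F R where
  app M := toTranslateZero F M ≫
    colimit.ι ((faceInclusion R ⋙ translation n) ⋙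
      (Functor.whiskeringRight (ParamSpace n) (ParamSpace n) (ModuleCat.{u} F)).obj M)
      (faceZero R)
  naturality M N f := by
    have h : f ≫ toTranslateZero F N =
        toTranslateZero F M ≫ Functor.whiskerLeft ((translation n).obj 0) f := by
      ext x : 2
      exact (f.naturality _).symm
    have h2 := ι_colimMap (Functor.whiskerLeft (faceInclusion R ⋙ translation n)
      ((Functor.whiskeringRight (ParamSpace n) (ParamSpace n) (ModuleCat.{u} F)).map f))
      (faceZero R)
    refine (Category.assoc _ _ _).symm.trans ((congrArg (· ≫ _) h).trans ?_)
    refine (Category.assoc _ _ _).trans ((congrArg (_ ≫ ·) h2.symm).trans ?_)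
    exact (Category.assoc _ _ _).symm

/-- The nonzero faces contained in the face spanned by `S`. -/
abbrev NonzeroSubface (S : Finset (Fin n)) : Type := {R : Finset (Fin n) // R.Nonempty ∧ R ⊆ S}

/-- The morphism from `M` to the product of its localizations along the nonzero faces contained
in the face spanned by `S`. -/
noncomputable def toLocalizations (S : Finset (Fin n)) (M : PersMod F n) :
    M ⟶ ∏ᶜ fun R : NonzeroSubface S => (localization F R.1).obj M :=
  Pi.lift fun R => (toLocalization F R.1).app M

/-- The `0`-th local cohomology with respect to the face spanned by `S`, on all persistence
modules: the kernel of `M ⟶ ∏ M_ρ`, where `ρ` ranges over the nonzero faces contained in the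
face spanned by `S`. -/
noncomputable def localCohomology₀ (S : Finset (Fin n)) : PersMod F n ⥤ PersMod F n where
  obj M := kernel (toLocalizations F S M)
  map {M N} f := kernel.map _ _ f (Limits.Pi.map fun R => (localization F R.1).map f) (by
    refine Limits.Pi.hom_ext _ _ fun R => ?_
    simpa [toLocalizations] using ((toLocalization F R.1).naturality f).symm)
  map_id M := by
    rw [← cancel_mono (kernel.ι _)]
    simp
  map_comp f g := by
    rw [← cancel_mono (kernel.ι _)]
    simp

variable {F}

theorem face_add {R : Finset (Fin n)} {s t : ParamSpace n} (hs : s ∈ face R) (ht : t ∈ face R) :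
    s + t ∈ face R :=
  ⟨add_nonneg hs.1 ht.1, fun i hi => by
    change s.coord i + t.coord i = 0
    rw [hs.2 i hi, ht.2 i hi, add_zero]⟩

instance (R : Finset (Fin n)) : Nonempty (face R) := ⟨faceZero R⟩

instance (R : Finset (Fin n)) : IsDirectedOrder (face R) where
  directed s t := ⟨⟨s.1 + t.1, face_add s.2 t.2⟩, le_add_of_nonneg_right t.2.1,
    le_add_of_nonneg_left s.2.1⟩

/-- The diagram of translates of `M` along a face. -/
noncomputable def translates (R : Finset (Fin n)) (M : PersMod F n) : face R ⥤ PersMod F n :=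
  (faceInclusion R ⋙ translation n) ⋙
    (Functor.whiskeringRight (ParamSpace n) (ParamSpace n) (ModuleCat.{u} F)).obj M

theorem exists_large (R : Finset (Fin n)) (T : Finset ℝ) (x y : ParamSpace n) :
    ∃ s : face R, ∀ t : face R, s ≤ t → ∀ i ∈ R, ∀ r ∈ T, r < (x + t.1).coord i ∧ r < (y + t.1).coord i := by
  classical
  have hB : 0 ≤ ∑ r ∈ T, |r| := Finset.sum_nonneg fun r _ => abs_nonneg r
  refine ⟨⟨fun i => if i ∈ R then (∑ r ∈ T, |r|) + |x.coord i| + |y.coord i| + 1 else 0, fun i => ?_,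
    fun i hi => if_neg hi⟩, fun t ht i hi r hr => ?_⟩
  · change (0 : ℝ) ≤ if i ∈ R then (∑ r ∈ T, |r|) + |x.coord i| + |y.coord i| + 1 else 0
    split_ifs <;> positivity
  · have h1 : (if i ∈ R then (∑ r ∈ T, |r|) + |x.coord i| + |y.coord i| + 1 else 0) ≤ t.1.coord i := ht i
    rw [if_pos hi] at h1
    have h2 : r ≤ ∑ r ∈ T, |r| :=
      (le_abs_self r).trans (Finset.single_le_sum (fun r _ => abs_nonneg r) hr)
    have h3 := neg_abs_le (x.coord i)
    have h4 := neg_abs_le (y.coord i)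
    have h5 := abs_nonneg (x.coord i)
    have h6 := abs_nonneg (y.coord i)
    constructor
    · change r < x.coord i + t.1.coord i
      linarith
    · change r < y.coord i + t.1.coord i
      linarith

theorem GridConstant.localization (R : Finset (Fin n)) {M : PersMod F n} (hM : GridConstant M) :
    GridConstant ((localization F R).obj M) := by
  obtain ⟨hfd, T, hT⟩ := hM
  have hι : ∀ x : ParamSpace n, ∃ s : face R, ∀ t : face R, s ≤ t →
      IsIso ((colimit.ι (translates R M) t).app x) := by
    intro x
    obtain ⟨s, hs⟩ := exists_large R T x x
    have hc : (translates R M ⋙ (evaluation _ (ModuleCat.{u} F)).obj x).IsEventuallyConstantFrom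
        s := by
      intro t f
      have hst : s.1 ≤ t.1 := leOfHom f
      refine hT (x + s.1) (x + t.1) (add_le_add_right hst x) fun i r hr => ?_
      by_cases hi : i ∈ R
      · have h1 := (hs s le_rfl i hi r hr).1
        have h2 := (hs t (leOfHom f) i hi r hr).1
        constructor
        · exact ⟨fun h => absurd h h1.le.not_gt, fun h => absurd h h2.le.not_gt⟩
        · exact ⟨fun h => absurd h h1.not_ge, fun h => absurd h h2.not_ge⟩
      · have h1 : (x + s.1).coord i = (x + t.1).coord i := by
          change x.coord i + s.1.coord i = x.coord i + t.1.coord i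
          rw [s.2.2 i hi, t.2.2 i hi]
        rw [h1]
        exact ⟨Iff.rfl, Iff.rfl⟩
    refine ⟨s, fun t hst => ?_⟩
    exact hc.isIso_ι_of_isColimit' (isColimitOfPreserves ((evaluation _ (ModuleCat.{u} F)).obj x)
      (colimit.isColimit (translates R M))) t (homOfLE hst)
  refine ⟨fun x => ?_, T, fun x y hxy hc => ?_⟩
  · obtain ⟨s, hs⟩ := hι x
    have := hs s le_rfl
    have : FiniteDimensional F (((translates R M).obj s).obj x) := hfd (x + s.1)
    exact Module.Finite.equiv (asIso ((colimit.ι (translates R M) s).app x)).toLinearEquiv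
  · obtain ⟨s₁, h₁⟩ := hι x
    obtain ⟨s₂, h₂⟩ := hι y
    obtain ⟨s₃, h₃⟩ := exists_large R T x y
    obtain ⟨s₄, h₄, h₅⟩ := exists_ge_ge s₁ s₂
    obtain ⟨s, h₆, h₇⟩ := exists_ge_ge s₃ s₄
    have i₁ := h₁ s (h₄.trans h₇)
    have i₂ := h₂ s (h₅.trans h₇)
    have i₃ : IsIso (((translates R M).obj s).map (homOfLE hxy)) := by
      refine hT (x + s.1) (y + s.1) (add_le_add_left hxy _) fun i r hr => ?_
      by_cases hi : i ∈ R
      · obtain ⟨h1, h2⟩ := h₃ s h₆ i hi r hr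
        constructor
        · exact ⟨fun h => absurd h h1.le.not_gt, fun h => absurd h h2.le.not_gt⟩
        · exact ⟨fun h => absurd h h1.not_ge, fun h => absurd h h2.not_ge⟩
      · have h1 : (x + s.1).coord i = x.coord i := by
          change x.coord i + s.1.coord i = x.coord i
          rw [s.2.2 i hi, add_zero]
        have h2 : (y + s.1).coord i = y.coord i := by
          change y.coord i + s.1.coord i = y.coord i
          rw [s.2.2 i hi, add_zero]
        rw [h1, h2]
        exact hc i r hr
    have hnat := (colimit.ι (translates R M) s).naturality (homOfLE hxy)
    have i₄ : IsIso ((colimit.ι (translates R M) s).app x ≫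
        (colimit (translates R M)).map (homOfLE hxy)) := by
      rw [← hnat]
      infer_instance
    exact @IsIso.of_isIso_comp_left _ _ _ _ _ _ _ i₁ i₄

theorem cubicallyEncoded_localCohomology₀ (S : Finset (Fin n)) {M : PersMod F n}
    (hM : cubicallyEncoded F n M) : cubicallyEncoded F n ((localCohomology₀ F S).obj M) :=
  (cubicallyEncoded F n).prop_kernel _ hM ((cubicallyEncoded F n).prop_product fun R =>
    ((cubicallyEncoded_iff_gridConstant _).1 hM |>.localization R.1).cubicallyEncoded)

variable (F)

/-- The `0`-th local cohomology with respect to the face spanned by `S`, as a functor from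
cubically encoded persistence modules to cubically encoded persistence modules. -/
noncomputable def cubicalH0 (S : Finset (Fin n)) : CubMod F n ⥤ CubMod F n :=
  (cubicallyEncoded F n).lift ((cubicallyEncoded F n).ι ⋙ localCohomology₀ F S) fun M =>
    cubicallyEncoded_localCohomology₀ S M.property

end LocalCohomology

section Amplitudes

variable {C : Type*} [Category* C] [Abelian C] {D : Type*} [Category* D] [Abelian D]

/-- An amplitude on an abelian category: a function on objects with values in `[0, ∞]` which
vanishes on zero objects and is monotone and subadditive on short exact sequences. -/
structure IsAmplitude (α : C → ℝ≥0∞) : Prop where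
  zero : ∀ Z : C, IsZero Z → α Z = 0
  mono_left : ∀ S : ShortComplex C, S.ShortExact → α S.X₁ ≤ α S.X₂
  mono_right : ∀ S : ShortComplex C, S.ShortExact → α S.X₃ ≤ α S.X₂
  subadditive : ∀ S : ShortComplex C, S.ShortExact → α S.X₂ ≤ α S.X₁ + α S.X₃

/-- `G` is amplitude-bounding with constant `K` from `(C, α)` to `(D, β)`. -/
def IsAmplitudeBounding (α : C → ℝ≥0∞) (β : D → ℝ≥0∞) (K : ℝ≥0) (G : C ⥤ D) : Prop :=
  G.Additive ∧ ∀ A : C, β (G.obj A) ≤ K * α A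

/-- Zigzags `A ⟵ C₁ ⟶ A₁ ⟵ C₂ ⟶ ⋯ ⟶ B`. -/
inductive MorphismZigzag : C → C → Type _
  | nil (A : C) : MorphismZigzag A A
  | cons {A C₁ A₁ B : C} (f : C₁ ⟶ A) (g : C₁ ⟶ A₁) (γ : MorphismZigzag A₁ B) : MorphismZigzag A B

/-- The cost of a morphism with respect to `α`. -/
noncomputable def morphismCost (α : C → ℝ≥0∞) {A B : C} (f : A ⟶ B) : ℝ≥0∞ :=
  α (kernel f) + α (cokernel f)

/-- The cost of a zigzag with respect to `α`: the sum of the costs of its morphisms. -/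
noncomputable def MorphismZigzag.cost (α : C → ℝ≥0∞) : {A B : C} → MorphismZigzag A B → ℝ≥0∞
  | _, _, .nil _ => 0
  | _, _, .cons f g γ => morphismCost α f + morphismCost α g + γ.cost α

/-- The path metric of `α`: the infimum of the costs of the zigzags between two objects. -/
noncomputable def pathDist (α : C → ℝ≥0∞) (A B : C) : ℝ≥0∞ :=
  ⨅ γ : MorphismZigzag A B, γ.cost α

end Amplitudes

/-- A map is `K`-Lipschitz with respect to extended distances `d` and `d'`. -/
def IsLipschitzFor {X Y : Type*} (d : X → X → ℝ≥0∞) (d' : Y → Y → ℝ≥0∞) (K : ℝ≥0)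
    (f : X → Y) : Prop :=
  ∀ a b, d' (f a) (f b) ≤ K * d a b

/-- A map is continuous with respect to extended distances `d` and `d'`. -/
def IsContinuousFor {X Y : Type*} (d : X → X → ℝ≥0∞) (d' : Y → Y → ℝ≥0∞) (f : X → Y) : Prop :=
  ∀ a, ∀ ε > 0, ∃ δ > 0, ∀ b, d a b < δ → d' (f a) (f b) < ε

section Distances

variable {F : Type u} [Field F] {n : ℕ}

theorem ParamSpace.le_add_add {v : ParamSpace n} (hv : 0 ≤ v) (ε : ℝ≥0) (x : ParamSpace n) :
    x ≤ x + (ε : ℝ) • v + (ε : ℝ) • v :=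
  (le_add_of_nonneg_right (ParamSpace.smul_nonneg' hv ε)).trans
    (le_add_of_nonneg_right (ParamSpace.smul_nonneg' hv ε))

/-- `M` and `N` are `ε`-interleaved along the vector `v`. -/
def IsInterleaved {v : ParamSpace n} (hv : 0 ≤ v) (ε : ℝ≥0) (M N : PersMod F n) : Prop :=
  ∃ (φ : M ⟶ (translation n).obj ((ε : ℝ) • v) ⋙ N)
    (ψ : N ⟶ (translation n).obj ((ε : ℝ) • v) ⋙ M),
    (∀ x, φ.app x ≫ ψ.app (x + (ε : ℝ) • v) =
      M.map (homOfLE (ParamSpace.le_add_add hv ε x))) ∧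
    (∀ x, ψ.app x ≫ φ.app (x + (ε : ℝ) • v) =
      N.map (homOfLE (ParamSpace.le_add_add hv ε x)))

/-- The interleaving distance along the vector `v` between cubically encoded modules. -/
noncomputable def interleavingDist {v : ParamSpace n} (hv : 0 ≤ v) (M N : CubMod F n) : ℝ≥0∞ :=
  ⨅ (ε : ℝ≥0) (_ : 0 < ε) (_ : IsInterleaved hv ε M.obj N.obj), (ε : ℝ≥0∞)

/-- `ℝⁿ` with the `σ`-algebra of Lebesgue measurable sets. -/
abbrev LebesgueSpace (n : ℕ) : Type := NullMeasurableSpace (Fin n → ℝ) volume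

/-- The Lebesgue measure on the `σ`-algebra of Lebesgue measurable sets of `ℝⁿ`. -/
noncomputable def lebesgueMeasure (n : ℕ) : Measure (LebesgueSpace n) :=
  (volume : Measure (Fin n → ℝ)).completion

/-- The dimension of a persistence module at a point of `ℝⁿ`. -/
noncomputable def hilbertFunction (M : CubMod F n) (x : LebesgueSpace n) : ℝ≥0∞ :=
  (Module.finrank F (M.obj.obj (show ParamSpace n from x)) : ℝ≥0∞)

/-- The `L^p` Hilbert amplitude: the `L^p`-norm of the Hilbert function with respect to `μ`. -/
noncomputable def hilbertAmplitude (μ : Measure (LebesgueSpace n)) (p : ℝ) (M : CubMod F n) :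
    ℝ≥0∞ :=
  (∫⁻ x, hilbertFunction M x ^ p ∂μ) ^ (1 / p)

end Distances

/-! ### Exactness in the category of cubically encoded modules, tested at points -/

section Fibers

variable {F : Type u} [Field F] {n : ℕ}

/-! Everything rests on a description of local cohomology by elements: `m` at `x` lies in `H⁰` of
`M` exactly when, for each `i ∈ S`, it dies after moving far enough in the single direction `e_i`
(`toLocalizations_app_eq_zero_iff`). Hence `H⁰` is a subfunctor of the identity. The bound on
amplitudes is monotonicity along the inclusion `H⁰ M ⟶ M`. Since morphisms into translates preserve
the property of dying in a direction, interleavings restrict to `H⁰`, which gives the interleaving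
bound.

For a finite measure, compare the constant module with the module equal to `F` on the orthant where
all coordinates are `< k` and zero elsewhere. Nothing dies in the former, so its `H⁰` is zero;
everything dies in every direction in the latter, so its `H⁰` has full support in the orthant. The
projection between them has kernel supported off the orthant, whose complement has measure tending
to `0`, so the modules converge while their `H⁰` stay apart. The separation uses that the amplitude
changes by at most the path distance (`le_add_pathDist`).

For the Lebesgue measure it suffices that `H⁰` does not raise the cost of any morphism `f`
(`pathDist_map_le`). The kernel of `H⁰ f` embeds in that of `f`. If `ker f` has infinite amplitude
there is nothing to prove. Otherwise `ker f` is constant on the cells of a grid, and an unbounded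
cell with nonempty interior has infinite volume, so for almost every `x` the kernel vanishes far out
on each ray from `x` in a direction `e_i` (`exists_forall_hilbertFunction_eq_zero`). At such an `x`,
if `f a` dies in direction `e_i`, then the image of `a` far out lies in `ker f`, hence is zero, so
`a` dies as well. Thus the map of cokernels is injective there (`injective_cokernel_map_cubicalH0`).
-/

instance preservesFiniteLimits_cubicallyEncoded_ι :
    PreservesFiniteLimits (cubicallyEncoded F n).ι := by
  have := fun {X Y : CubMod F n} (f : X ⟶ Y) => (cubicallyEncoded F n).preservesKernels_ι f
  exact (cubicallyEncoded F n).ι.preservesFiniteLimits_of_preservesKernels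

instance preservesFiniteColimits_cubicallyEncoded_ι :
    PreservesFiniteColimits (cubicallyEncoded F n).ι := by
  have := fun {X Y : CubMod F n} (f : X ⟶ Y) => (cubicallyEncoded F n).preservesCokernels_ι f
  exact (cubicallyEncoded F n).ι.preservesFiniteColimits_of_preservesCokernels

variable (F) in
/-- The functor sending a cubically encoded module to its value at a point. -/
noncomputable def fiber (x : ParamSpace n) : CubMod F n ⥤ ModuleCat.{u} F :=
  (cubicallyEncoded F n).ι ⋙ (evaluation _ (ModuleCat.{u} F)).obj x

instance (x : ParamSpace n) : PreservesFiniteLimits (fiber F x) :=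
  inferInstanceAs (PreservesFiniteLimits (_ ⋙ _))

instance (x : ParamSpace n) : PreservesFiniteColimits (fiber F x) :=
  inferInstanceAs (PreservesFiniteColimits (_ ⋙ _))

instance (x : ParamSpace n) : (fiber F x).Additive :=
  inferInstanceAs (Functor.Additive (_ ⋙ _))

instance (M : CubMod F n) (x : ParamSpace n) : FiniteDimensional F (M.obj.obj x) :=
  ((cubicallyEncoded_iff_gridConstant _).1 M.property).1 x

theorem injective_app_of_mono {A B : CubMod F n} (f : A ⟶ B) [Mono f] (x : ParamSpace n) :
    Function.Injective (f.hom.app x) :=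
  (ModuleCat.mono_iff_injective _).1 (inferInstanceAs (Mono ((fiber F x).map f)))

theorem surjective_app_of_epi {A B : CubMod F n} (f : A ⟶ B) [Epi f] (x : ParamSpace n) :
    Function.Surjective (f.hom.app x) :=
  (ModuleCat.epi_iff_surjective _).1 (inferInstanceAs (Epi ((fiber F x).map f)))

theorem ShortComplex.Exact.function_exact_app {S : ShortComplex (CubMod F n)} (hS : S.Exact)
    (x : ParamSpace n) : Function.Exact (S.f.hom.app x) (S.g.hom.app x) :=
  (ShortComplex.ShortExact.moduleCat_exact_iff_function_exact _).1 (hS.map (fiber F x))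

theorem exact_app_kernel {A B : CubMod F n} (f : A ⟶ B) (x : ParamSpace n) :
    Function.Exact ((kernel.ι f).hom.app x) (f.hom.app x) :=
  ShortComplex.Exact.function_exact_app (S := ShortComplex.mk _ _ (kernel.condition f))
    (ShortComplex.exact_of_f_is_kernel _ (kernelIsKernel f)) x

theorem exact_app_cokernel {A B : CubMod F n} (f : A ⟶ B) (x : ParamSpace n) :
    Function.Exact (f.hom.app x) ((cokernel.π f).hom.app x) :=
  ShortComplex.Exact.function_exact_app (S := ShortComplex.mk _ _ (cokernel.condition f))
    (ShortComplex.exact_of_g_is_cokernel _ (cokernelIsCokernel f)) x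

theorem comp_hom_app_apply {A B C : CubMod F n} (f : A ⟶ B) (g : B ⟶ C) (x : ParamSpace n)
    (a : A.obj.obj x) : (f ≫ g).hom.app x a = g.hom.app x (f.hom.app x a) := rfl

theorem hom_ext_app {A B : CubMod F n} {f g : A ⟶ B}
    (h : ∀ x (a : A.obj.obj x), f.hom.app x a = g.hom.app x a) : f = g := by
  ext x a
  exact h x a

theorem mono_of_injective_app {A B : CubMod F n} (f : A ⟶ B)
    (h : ∀ x, Function.Injective (f.hom.app x)) : Mono f :=
  ⟨fun a b hab => hom_ext_app fun x c => h x (by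
    rw [← comp_hom_app_apply, ← comp_hom_app_apply, hab])⟩

end Fibers

/-! ### Local cohomology by elements; amplitude and interleaving bounds -/

section LocalCohomology

variable {F : Type u} [Field F] {n : ℕ}

/-- The element `m` of `M` at `x` is mapped to zero by some structure map in a direction lying in
the face spanned by `R`. -/
def VanishesAlong (R : Finset (Fin n)) (M : PersMod F n) (x : ParamSpace n) (m : M.obj x) : Prop :=
  ∃ (y : ParamSpace n) (h : x ≤ y), (∀ j, j ∉ R → y.coord j = x.coord j) ∧ M.map (homOfLE h) m = 0

theorem VanishesAlong.mono {R R' : Finset (Fin n)} (hR : R ⊆ R') {M : PersMod F n}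
    {x : ParamSpace n} {m : M.obj x} (h : VanishesAlong R M x m) : VanishesAlong R' M x m := by
  obtain ⟨y, hxy, hy, h0⟩ := h
  exact ⟨y, hxy, fun j hj => hy j fun hj' => hj (hR hj'), h0⟩

theorem map_map_apply (M : PersMod F n) {x y z : ParamSpace n} (h : x ≤ y) (h' : y ≤ z)
    (m : M.obj x) :
    M.map (homOfLE h') (M.map (homOfLE h) m) = M.map (homOfLE (h.trans h')) m := by
  rw [← ConcreteCategory.comp_apply, ← M.map_comp]
  rfl

/-- Colimits of persistence modules are computed pointwise, and an element of a directed colimit of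
vector spaces is zero iff it becomes zero at some stage. -/
theorem toLocalization_app_app_eq_zero_iff (R : Finset (Fin n)) (M : PersMod F n)
    (x : ParamSpace n) (m : M.obj x) :
    ((toLocalization F R).app M).app x m = 0 ↔ VanishesAlong R M x m := by
  -- The face is a category in universe `0`, while the modules live in universe `u`.
  have := preservesFilteredColimitsOfSize_shrink.{0, u, 0, u} (forget (ModuleCat.{u} F))
  let E := (evaluation (ParamSpace n) (ModuleCat.{u} F)).obj x
  let D : face R ⥤ ModuleCat.{u} F := translates R M ⋙ E
  let m₀ : D.obj (faceZero R) := M.map (homOfLE (add_zero x).ge) m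
  have h1 : ((toLocalization F R).app M).app x m = 0 ↔
      ∃ (k : face R) (f g : faceZero R ⟶ k), D.map f m₀ = D.map g 0 := by
    refine Iff.trans ?_ (Concrete.isColimit_rep_eq_iff_exists D (isColimitOfPreserves E
      (colimit.isColimit (translates R M))) (i := faceZero R) (j := faceZero R) m₀ 0)
    refine Iff.trans ?_ (Eq.congr_right (map_zero (ConcreteCategory.hom
      ((E.mapCocone (colimit.cocone (translates R M))).ι.app (faceZero R))))).symm
    exact Iff.rfl
  have h2 : ∀ s (hs : s ∈ face R) (f : faceZero R ⟶ ⟨s, hs⟩), D.map f m₀ =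
      M.map (homOfLE (le_add_of_nonneg_right (show 0 ≤ s from hs.1) : x ≤ x + s)) m := fun s hs f =>
    map_map_apply M (add_zero x).ge (add_le_add_right (show 0 ≤ s from hs.1) x) m
  rw [h1]
  constructor
  · rintro ⟨⟨s, hs⟩, f, g, h⟩
    refine ⟨x + s, le_add_of_nonneg_right (show 0 ≤ s from hs.1), fun j hj => ?_, ?_⟩
    · change x.coord j + s.coord j = x.coord j
      rw [hs.2 j hj, add_zero]
    · exact (h2 s hs f).symm.trans (h.trans (map_zero (ConcreteCategory.hom (D.map g))))
  · rintro ⟨y, hxy, hy, h⟩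
    obtain ⟨s, rfl⟩ : ∃ s, y = x + s := ⟨y - x, (add_sub_cancel x y).symm⟩
    have h0 : 0 ≤ s := le_of_add_le_add_left (a := x) (by rwa [add_zero])
    have hs : s ∈ face R := by
      refine ⟨h0, fun j hj => ?_⟩
      have : x.coord j + s.coord j = x.coord j := hy j hj
      linarith
    let f : faceZero R ⟶ ⟨s, hs⟩ := homOfLE h0
    exact ⟨⟨s, hs⟩, f, f, (h2 s hs f).trans
      (h.trans (map_zero (ConcreteCategory.hom (D.map f))).symm)⟩

/-- Rays suffice: an element that dies along the ray of some `i ∈ R` dies along the whole face of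
`R`, and every nonzero face contains a ray. -/
theorem toLocalizations_app_eq_zero_iff (S : Finset (Fin n)) (M : PersMod F n)
    (x : ParamSpace n) (m : M.obj x) :
    (toLocalizations F S M).app x m = 0 ↔ ∀ i ∈ S, VanishesAlong {i} M x m := by
  have h1 : (toLocalizations F S M).app x m = 0 ↔
      ∀ R : NonzeroSubface S, VanishesAlong R.1 M x m := by
    have hl := isLimitOfPreserves ((evaluation _ (ModuleCat.{u} F)).obj x)
      (limit.isLimit (Discrete.functor fun R : NonzeroSubface S => (localization F R.1).obj M))
    have hπ : ∀ R : NonzeroSubface S,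
        (Pi.π (fun R : NonzeroSubface S => (localization F R.1).obj M) R).app x
          ((toLocalizations F S M).app x m) = ((toLocalization F R.1).app M).app x m := fun R => by
      rw [← ConcreteCategory.comp_apply, ← NatTrans.comp_app, toLocalizations, Pi.lift_π]
    simp_rw [← toLocalization_app_app_eq_zero_iff, ← hπ]
    constructor
    · intro h R
      rw [h, map_zero]
    · intro h
      refine Concrete.isLimit_ext _ hl _ _ ?_
      rintro ⟨R⟩
      exact (h R).trans (map_zero (ConcreteCategory.hom
        ((Pi.π (fun R : NonzeroSubface S => (localization F R.1).obj M) R).app x))).symm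
  rw [h1]
  constructor
  · intro h i hi
    exact h ⟨{i}, Finset.singleton_nonempty i, Finset.singleton_subset_iff.2 hi⟩
  · rintro h ⟨R, ⟨i, hi⟩, hR⟩
    exact (h i (hR hi)).mono (Finset.singleton_subset_iff.2 hi)

variable (F) in
/-- The inclusion of the `0`-th local cohomology. -/
noncomputable def localCohomology₀Inclusion (S : Finset (Fin n)) :
    localCohomology₀ F S ⟶ 𝟭 (PersMod F n) where
  app M := kernel.ι (toLocalizations F S M)
  naturality _ _ _ := kernel.lift_ι _ _ _

theorem injective_localCohomology₀Inclusion (S : Finset (Fin n)) (M : PersMod F n)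
    (x : ParamSpace n) :
    Function.Injective (((localCohomology₀Inclusion F S).app M).app x) := by
  have : Mono ((localCohomology₀Inclusion F S).app M) :=
    inferInstanceAs (Mono (kernel.ι (toLocalizations F S M)))
  exact (ModuleCat.mono_iff_injective _).1 inferInstance

theorem mem_range_localCohomology₀Inclusion (S : Finset (Fin n)) (M : PersMod F n)
    (x : ParamSpace n) (m : M.obj x) :
    m ∈ Set.range (((localCohomology₀Inclusion F S).app M).app x) ↔
      ∀ i ∈ S, VanishesAlong {i} M x m := by
  rw [← toLocalizations_app_eq_zero_iff]
  have hex : (ShortComplex.mk _ _ (kernel.condition (toLocalizations F S M))).Exact :=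
    ShortComplex.exact_of_f_is_kernel _ (kernelIsKernel _)
  exact ((ShortComplex.ShortExact.moduleCat_exact_iff_function_exact _).1
    (hex.map ((evaluation _ (ModuleCat.{u} F)).obj x)) m).symm

/-- A pointwise injective `f` is the kernel of its cokernel, and `g` composed with that cokernel
vanishes pointwise. This lets morphisms into `H⁰` be built by checking elements. -/
theorem exists_lift_of_forall_mem_range {K A B : PersMod F n} (f : A ⟶ B)
    (hf : ∀ x, Function.Injective (f.app x)) (g : K ⟶ B)
    (hg : ∀ x k, g.app x k ∈ Set.range (f.app x)) : ∃ l : K ⟶ A, l ≫ f = g := by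
  have : ∀ x, Mono (f.app x) := fun x => (ModuleCat.mono_iff_injective _).2 (hf x)
  have : Mono f := NatTrans.mono_of_mono_app f
  have h0 : g ≫ cokernel.π f = 0 := by
    ext x k
    obtain ⟨a, ha⟩ := hg x k
    change (cokernel.π f).app x (g.app x k) = 0
    rw [← ha, ← ConcreteCategory.comp_apply, ← NatTrans.comp_app, cokernel.condition]
    rfl
  exact ⟨Abelian.monoLift f g h0, Abelian.monoLift_comp f g h0⟩

theorem VanishesAlong.map_translation {R : Finset (Fin n)} {M N : PersMod F n} {s : ParamSpace n}
    (φ : M ⟶ (translation n).obj s ⋙ N) {x : ParamSpace n} {m : M.obj x}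
    (h : VanishesAlong R M x m) : VanishesAlong R N (x + s) (φ.app x m) := by
  obtain ⟨y, hxy, hy, h0⟩ := h
  refine ⟨y + s, add_le_add_left hxy s, fun j hj => ?_, ?_⟩
  · change y.coord j + s.coord j = x.coord j + s.coord j
    rw [hy j hj]
  · have := NatTrans.naturality_apply φ (homOfLE hxy) m
    rw [h0, map_zero] at this
    exact this.symm

theorem exists_localCohomology₀_translation (S : Finset (Fin n)) {M N : PersMod F n}
    {s : ParamSpace n} (φ : M ⟶ (translation n).obj s ⋙ N) :
    ∃ φ' : (localCohomology₀ F S).obj M ⟶ (translation n).obj s ⋙ (localCohomology₀ F S).obj N,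
      φ' ≫ Functor.whiskerLeft ((translation n).obj s) ((localCohomology₀Inclusion F S).app N) =
        (localCohomology₀Inclusion F S).app M ≫ φ := by
  refine exists_lift_of_forall_mem_range _
    (fun x => injective_localCohomology₀Inclusion S N (x + s)) _ fun x k => ?_
  refine (mem_range_localCohomology₀Inclusion S N (x + s) _).2 fun i hi => ?_
  exact ((mem_range_localCohomology₀Inclusion S M x _).1 ⟨k, rfl⟩ i hi).map_translation φ

theorem isInterleaved_localCohomology₀ (S : Finset (Fin n)) {v : ParamSpace n} {hv : 0 ≤ v}
    {ε : ℝ≥0} {M N : PersMod F n} (h : IsInterleaved hv ε M N) :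
    IsInterleaved hv ε ((localCohomology₀ F S).obj M) ((localCohomology₀ F S).obj N) := by
  obtain ⟨φ, ψ, h1, h2⟩ := h
  obtain ⟨φ', hφ⟩ := exists_localCohomology₀_translation S φ
  obtain ⟨ψ', hψ⟩ := exists_localCohomology₀_translation S ψ
  -- The elementwise form of the defining square of the restricted morphism. The interleaving
  -- identities are then checked after the injective inclusion of `H⁰`.
  have aux : ∀ {M N : PersMod F n} {s : ParamSpace n} {φ : M ⟶ (translation n).obj s ⋙ N}
      {φ' : (localCohomology₀ F S).obj M ⟶ (translation n).obj s ⋙ (localCohomology₀ F S).obj N},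
      φ' ≫ Functor.whiskerLeft ((translation n).obj s) ((localCohomology₀Inclusion F S).app N) =
        (localCohomology₀Inclusion F S).app M ≫ φ → ∀ x m,
      ((localCohomology₀Inclusion F S).app N).app (x + s) (φ'.app x m) =
        φ.app x (((localCohomology₀Inclusion F S).app M).app x m) := by
    intro M N s φ φ' h x m
    exact congrArg (fun f => (f.app x).hom m) h
  refine ⟨φ', ψ', fun x => ?_, fun x => ?_⟩
  · ext m
    refine injective_localCohomology₀Inclusion S M _ ?_
    refine (aux hψ _ _).trans ((congrArg _ (aux hφ x m)).trans ?_)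
    refine Eq.trans ?_ (NatTrans.naturality_apply ((localCohomology₀Inclusion F S).app M) _ m).symm
    exact congrArg (fun f => f.hom (((localCohomology₀Inclusion F S).app M).app x m)) (h1 x)
  · ext m
    refine injective_localCohomology₀Inclusion S N _ ?_
    refine (aux hφ _ _).trans ((congrArg _ (aux hψ x m)).trans ?_)
    refine Eq.trans ?_ (NatTrans.naturality_apply ((localCohomology₀Inclusion F S).app N) _ m).symm
    exact congrArg (fun f => f.hom (((localCohomology₀Inclusion F S).app N).app x m)) (h2 x)

theorem isLipschitzFor_interleavingDist_cubicalH0 (S : Finset (Fin n)) {v : ParamSpace n}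
    (hv : 0 ≤ v) :
    IsLipschitzFor (interleavingDist hv) (interleavingDist hv) 1 (cubicalH0 F S).obj := by
  intro M N
  rw [ENNReal.coe_one, one_mul]
  refine le_iInf fun ε => le_iInf fun hε => le_iInf fun h => ?_
  exact iInf_le_of_le ε (iInf_le_of_le hε (iInf_le_of_le (isInterleaved_localCohomology₀ S h) le_rfl))

variable (F) in
/-- The inclusion of the `0`-th local cohomology of cubically encoded modules. -/
noncomputable def cubicalH0Inclusion (S : Finset (Fin n)) : cubicalH0 F S ⟶ 𝟭 (CubMod F n) where
  app M := ObjectProperty.homMk ((localCohomology₀Inclusion F S).app M.obj)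
  naturality _ _ f := by
    ext1
    exact (localCohomology₀Inclusion F S).naturality f.hom

theorem injective_cubicalH0Inclusion (S : Finset (Fin n)) (M : CubMod F n) (x : ParamSpace n) :
    Function.Injective (((cubicalH0Inclusion F S).app M).hom.app x) :=
  injective_localCohomology₀Inclusion S M.obj x

theorem mem_range_cubicalH0Inclusion (S : Finset (Fin n)) (M : CubMod F n)
    (x : ParamSpace n) (m : M.obj.obj x) :
    m ∈ Set.range (((cubicalH0Inclusion F S).app M).hom.app x) ↔
      ∀ i ∈ S, VanishesAlong {i} M.obj x m :=
  mem_range_localCohomology₀Inclusion S M.obj x m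

instance (S : Finset (Fin n)) (M : CubMod F n) : Mono ((cubicalH0Inclusion F S).app M) :=
  mono_of_injective_app _ (injective_cubicalH0Inclusion S M)

theorem cubicalH0_map_comp_inclusion (S : Finset (Fin n)) {M N : CubMod F n} (f : M ⟶ N) :
    (cubicalH0 F S).map f ≫ (cubicalH0Inclusion F S).app N =
      (cubicalH0Inclusion F S).app M ≫ f :=
  (cubicalH0Inclusion F S).naturality f

/-- A functor with a natural monomorphism to the identity is additive: compare both sides after the
inclusion. -/
instance (S : Finset (Fin n)) : (cubicalH0 F S).Additive where
  map_add {M N f g} := by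
    rw [← cancel_mono ((cubicalH0Inclusion F S).app N), Preadditive.add_comp,
      cubicalH0_map_comp_inclusion, cubicalH0_map_comp_inclusion, cubicalH0_map_comp_inclusion,
      Preadditive.comp_add]

theorem isAmplitudeBounding_cubicalH0 (S : Finset (Fin n)) {α : CubMod F n → ℝ≥0∞}
    (hα : IsAmplitude α) : IsAmplitudeBounding α α 1 (cubicalH0 F S) := by
  refine ⟨inferInstance, fun M => ?_⟩
  rw [ENNReal.coe_one, one_mul]
  let f := (cubicalH0Inclusion F S).app M
  have : Mono f := inferInstanceAs (Mono ((cubicalH0Inclusion F S).app M))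
  exact hα.mono_left (ShortComplex.mk f (cokernel.π f) (cokernel.condition f))
    { exact := ShortComplex.exact_of_g_is_cokernel _ (cokernelIsCokernel f)
      mono_f := this
      epi_g := inferInstanceAs (Epi (cokernel.π f)) }

end LocalCohomology

/-! ### Path metrics of general cost functions -/

section Zigzags

variable {C : Type*} [Category* C] [Abelian C] {D : Type*} [Category* D] [Abelian D]

theorem pathDist_map_le {α : C → ℝ≥0∞} {β : D → ℝ≥0∞} (G : C ⥤ D)
    (h : ∀ {A B : C} (f : A ⟶ B), morphismCost β (G.map f) ≤ morphismCost α f) (A B : C) :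
    pathDist β (G.obj A) (G.obj B) ≤ pathDist α A B := by
  refine le_iInf fun γ => ?_
  induction γ with
  | nil A => exact iInf_le_of_le (.nil _) le_rfl
  | @cons A C₁ A₁ B f g γ ih =>
    refine le_trans ?_ (add_le_add (add_le_add (h f) (h g)) ih)
    -- The image span is put in front of an arbitrary zigzag, so its cost is moved under the
    -- infimum.
    rw [pathDist, pathDist, ENNReal.add_iInf]
    exact le_iInf fun γ' =>
      iInf_le (fun γ => MorphismZigzag.cost β γ) (.cons (G.map f) (G.map g) γ')

/-- Along a span `A ⟵ C₁ ⟶ A₁`, passing from `A` to `C₁` costs at most the kernel of the first leg,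
and from `C₁` to `A₁` at most the cokernel of the second. These are two of the four terms in the
cost of the span. -/
theorem le_add_pathDist {α : C → ℝ≥0∞}
    (hker : ∀ {A B : C} (f : A ⟶ B), α A ≤ α (kernel f) + α B)
    (hcoker : ∀ {A B : C} (f : A ⟶ B), α B ≤ α A + α (cokernel f)) (A B : C) :
    α B ≤ α A + pathDist α A B := by
  rw [pathDist, ENNReal.add_iInf]
  refine le_iInf fun γ => ?_
  induction γ with
  | nil A => exact le_self_add
  | @cons A C₁ A₁ B f g γ ih =>
    calc α B ≤ α A₁ + γ.cost α := ih
      _ ≤ (α (kernel f) + α A + α (cokernel g)) + γ.cost α := by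
          gcongr
          exact (hcoker g).trans (by gcongr; exact hker f)
      _ = α A + (α (kernel f) + α (cokernel g) + γ.cost α) := by ring
      _ ≤ α A + ((α (kernel f) + α (cokernel f)) + (α (kernel g) + α (cokernel g))
            + γ.cost α) := by
          gcongr
          · exact le_self_add
          · exact le_add_self

/-- Zigzags consist of spans, so the backward leg is filled with an identity. -/
theorem pathDist_le_of_hom {α : C → ℝ≥0∞} {A B : C} (f : A ⟶ B) :
    pathDist α A B ≤ morphismCost α (𝟙 A) + morphismCost α f :=
  iInf_le_of_le (.cons (𝟙 A) f (.nil B)) (add_zero _).le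

end Zigzags

/-! ### Hilbert functions and their `L^p` amplitudes -/

section Hilbert

variable {F : Type u} [Field F] {n : ℕ}

theorem finrank_le_add_of_exact {U V W : Type*} [AddCommGroup U] [Module F U] [AddCommGroup V]
    [Module F V] [AddCommGroup W] [Module F W] [FiniteDimensional F U] [FiniteDimensional F V]
    [FiniteDimensional F W] (f : U →ₗ[F] V) (g : V →ₗ[F] W) (h : Function.Exact f g) :
    Module.finrank F V ≤ Module.finrank F U + Module.finrank F W := by
  rw [← g.finrank_range_add_finrank_ker, add_comm, LinearMap.exact_iff.1 h]
  exact add_le_add f.finrank_range_le (Submodule.finrank_le _)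

theorem hilbertFunction_le_kernel_add {A B : CubMod F n} (f : A ⟶ B) (x : ParamSpace n) :
    hilbertFunction A x ≤ hilbertFunction (kernel f) x + hilbertFunction B x := by
  unfold hilbertFunction
  exact_mod_cast finrank_le_add_of_exact _ _ (exact_app_kernel f x)

theorem hilbertFunction_le_add_cokernel {A B : CubMod F n} (f : A ⟶ B) (x : ParamSpace n) :
    hilbertFunction B x ≤ hilbertFunction A x + hilbertFunction (cokernel f) x := by
  unfold hilbertFunction
  exact_mod_cast finrank_le_add_of_exact _ _ (exact_app_cokernel f x)

theorem hilbertFunction_le_of_injective {A B : CubMod F n} (f : A ⟶ B) (x : ParamSpace n)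
    (hf : Function.Injective (f.hom.app x)) : hilbertFunction A x ≤ hilbertFunction B x := by
  unfold hilbertFunction
  exact_mod_cast LinearMap.finrank_le_finrank_of_injective (f := (f.hom.app x).hom) hf

theorem hilbertFunction_eq_zero_iff (A : CubMod F n) (x : ParamSpace n) :
    hilbertFunction A x = 0 ↔ ∀ a : A.obj.obj x, a = 0 := by
  unfold hilbertFunction
  rw [Nat.cast_eq_zero]
  exact Module.finrank_zero_iff.trans (subsingleton_iff_forall_eq 0)

theorem one_le_hilbertFunction {A : CubMod F n} {x : LebesgueSpace n}
    (h : hilbertFunction A x ≠ 0) : 1 ≤ hilbertFunction A x := by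
  unfold hilbertFunction at h ⊢
  rw [Nat.cast_ne_zero] at h
  exact_mod_cast Nat.one_le_iff_ne_zero.2 h

theorem hilbertFunction_kernel_eq_zero {A B : CubMod F n} (f : A ⟶ B) (x : ParamSpace n)
    (hf : Function.Injective (f.hom.app x)) : hilbertFunction (kernel f) x = 0 := by
  refine (hilbertFunction_eq_zero_iff _ _).2 fun k => ?_
  refine injective_app_of_mono (kernel.ι f) x (hf ?_)
  exact ((exact_app_kernel f x).apply_apply_eq_zero k).trans (by simp)

theorem hilbertFunction_cokernel_eq_zero {A B : CubMod F n} (f : A ⟶ B) (x : ParamSpace n)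
    (hf : Function.Surjective (f.hom.app x)) : hilbertFunction (cokernel f) x = 0 := by
  refine (hilbertFunction_eq_zero_iff _ _).2 fun c => ?_
  obtain ⟨b, rfl⟩ := surjective_app_of_epi (cokernel.π f) x c
  obtain ⟨a, rfl⟩ := hf b
  exact (exact_app_cokernel f x).apply_apply_eq_zero a

theorem IsCubical.measurableSet {S : Set (ParamSpace n)} (hS : IsCubical S) :
    @MeasurableSet (Fin n → ℝ) _ S := by
  obtain ⟨𝒞, hfin, hC, rfl⟩ := hS
  refine MeasurableSet.sUnion hfin.countable fun C hmem => ?_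
  obtain ⟨I, hI, rfl⟩ := hC C hmem
  have : {x : Fin n → ℝ | ∀ i, x i ∈ I i} = Set.pi Set.univ I := by
    ext x
    simp
  refine (congrArg (@MeasurableSet (Fin n → ℝ) _) this).mpr ?_
  exact MeasurableSet.univ_pi fun i => (hI i).measurableSet

/-- The Hilbert function factors through the encoding map, whose fibres are finite unions of cubes
and hence Borel. -/
theorem measurable_hilbertFunction (M : CubMod F n) : Measurable (hilbertFunction M) := by
  obtain ⟨P, _, _, e, M', -, hfib, ⟨η⟩⟩ := M.property
  let _ : MeasurableSpace P := ⊤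
  have he : @Measurable (LebesgueSpace n) P _ _ e := by
    refine @measurable_to_countable' P (LebesgueSpace n) _ _ _ e fun p => ?_
    exact (hfib p).measurableSet.nullMeasurableSet
  have h : hilbertFunction M = (fun p => (Module.finrank F (M'.obj p) : ℝ≥0∞)) ∘ e := by
    funext x
    exact congrArg Nat.cast (η.app x).toLinearEquiv.finrank_eq
  rw [h]
  exact measurable_from_top.comp he

/-- Points of one cell need not be comparable; both are compared with `x ⊓ y`, which lies in the
same cell. -/
theorem hilbertFunction_eq_of_sameCell {M : CubMod F n} {T : Finset ℝ}
    (hT : ∀ (x y : ParamSpace n) (h : x ≤ y), SameCell T x y → IsIso (M.obj.map (homOfLE h)))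
    {x y : ParamSpace n} (h : SameCell T x y) : hilbertFunction M x = hilbertFunction M y := by
  have aux : ∀ {x y : ParamSpace n} (hxy : x ≤ y), SameCell T x y →
      hilbertFunction M x = hilbertFunction M y := fun hxy hc => by
    have := hT _ _ hxy hc
    exact congrArg Nat.cast (asIso (M.obj.map (homOfLE hxy))).toLinearEquiv.finrank_eq
  rw [← aux inf_le_left h.inf]
  exact aux inf_le_right (by rw [inf_comm]; exact h.symm.inf)

variable {μ : Measure (LebesgueSpace n)} {p : ℝ}

/-- The almost-everywhere form is needed for cokernels, which are compared only off the threshold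
hyperplanes. -/
theorem hilbertAmplitude_mono (hp : 1 ≤ p) {A B : CubMod F n}
    (h : ∀ᵐ x ∂μ, hilbertFunction A x ≤ hilbertFunction B x) :
    hilbertAmplitude μ p A ≤ hilbertAmplitude μ p B := by
  refine ENNReal.rpow_le_rpow (lintegral_mono_ae ?_) (by positivity)
  filter_upwards [h] with x hx
  exact ENNReal.rpow_le_rpow hx (by positivity)

/-- Minkowski's inequality. -/
theorem hilbertAmplitude_le_add (hp : 1 ≤ p) {A B C : CubMod F n}
    (h : ∀ x, hilbertFunction B x ≤ hilbertFunction A x + hilbertFunction C x) :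
    hilbertAmplitude μ p B ≤ hilbertAmplitude μ p A + hilbertAmplitude μ p C := by
  refine le_trans (ENNReal.rpow_le_rpow (lintegral_mono fun x => ?_) (by positivity))
    (ENNReal.lintegral_Lp_add_le (measurable_hilbertFunction A).aemeasurable
      (measurable_hilbertFunction C).aemeasurable hp)
  exact ENNReal.rpow_le_rpow (h x) (by positivity)

theorem hilbertAmplitude_eq_zero (hp : 1 ≤ p) {A : CubMod F n}
    (h : ∀ x, hilbertFunction A x = 0) : hilbertAmplitude μ p A = 0 := by
  have hp0 : 0 < p := by positivity
  simp [hilbertAmplitude, h, hp0]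

theorem hilbertAmplitude_le_of_le_indicator (hp : 1 ≤ p) {A : CubMod F n}
    {U : Set (LebesgueSpace n)} (h : ∀ x, hilbertFunction A x ≤ U.indicator 1 x) :
    hilbertAmplitude μ p A ≤ μ U ^ (1 / p) := by
  have hp0 : 0 < p := by positivity
  refine ENNReal.rpow_le_rpow ((lintegral_mono fun x => ?_).trans
    (lintegral_indicator_one_le U)) (by positivity)
  refine (ENNReal.rpow_le_rpow (h x) hp0.le).trans ?_
  by_cases hx : x ∈ U <;> simp [hx, hp0]

/-- Markov's inequality at level `1`: a nonzero dimension is at least `1`. The set `U` need not be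
measurable. -/
theorem le_hilbertAmplitude (hp : 1 ≤ p) {A : CubMod F n}
    {U : Set (LebesgueSpace n)} (h : ∀ x ∈ U, hilbertFunction A x ≠ 0) :
    μ U ^ (1 / p) ≤ hilbertAmplitude μ p A := by
  have hp0 : 0 < p := by positivity
  refine ENNReal.rpow_le_rpow ?_ (by positivity)
  refine le_trans (measure_mono fun x hx => ?_) ((one_mul _).symm.le.trans
    (mul_meas_ge_le_lintegral₀ ((measurable_hilbertFunction A).pow_const p).aemeasurable 1))
  exact ENNReal.one_le_rpow (one_le_hilbertFunction (h x hx)) hp0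

theorem hilbertAmplitude_le_add_pathDist (hp : 1 ≤ p) (A B : CubMod F n) :
    hilbertAmplitude μ p B ≤ hilbertAmplitude μ p A + pathDist (hilbertAmplitude μ p) A B :=
  le_add_pathDist (fun f => hilbertAmplitude_le_add hp (hilbertFunction_le_kernel_add f))
    (fun f => hilbertAmplitude_le_add hp (hilbertFunction_le_add_cokernel f)) A B

end Hilbert

/-! ### The Lipschitz bound for the Lebesgue measure -/

section Lebesgue

variable {F : Type u} [Field F] {n : ℕ} {p : ℝ}

/-- A threshold separating two points of an interval would itself belong to the interval. -/
theorem sameCell_of_ordConnected {T : Finset ℝ} {I : Fin n → Set ℝ}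
    (hI : ∀ i, (I i).OrdConnected) (hT : ∀ i, ∀ t ∈ T, t ∉ I i) {x y : ParamSpace n}
    (hx : ∀ i, x.coord i ∈ I i) (hy : ∀ i, y.coord i ∈ I i) : SameCell T x y := by
  have aux : ∀ {x y : ParamSpace n}, (∀ i, x.coord i ∈ I i) → (∀ i, y.coord i ∈ I i) →
      ∀ i, ∀ t ∈ T, x.coord i ≤ t → y.coord i < t := fun hx hy i t ht hxt => by
    by_contra! hc
    exact hT i t ht ((hI i).out (hx i) (hy i) ⟨hxt, hc⟩)
  intro i t ht
  exact ⟨⟨fun h => aux hx hy i t ht h.le, fun h => aux hy hx i t ht h.le⟩,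
    ⟨fun h => (aux hx hy i t ht h).le, fun h => (aux hy hx i t ht h).le⟩⟩

theorem volume_sameCell_eq_top {T : Finset ℝ} (y : ParamSpace n)
    (hy : ∀ j, y.coord j ∉ T) (i : Fin n) (hi : ∀ t ∈ T, t < y.coord i) :
    lebesgueMeasure n {z | SameCell T y z} = ∞ := by
  have hball : ∀ j, ∃ r > 0, ∀ t ∈ T, t ∉ Metric.ball (y.coord j) r := fun j => by
    obtain ⟨r, hr, h⟩ := Metric.isOpen_iff.1 (T.finite_toSet.isClosed.isOpen_compl)
      (y.coord j) (hy j)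
    exact ⟨r, hr, fun t ht hm => h hm ht⟩
  choose r hr hrT using hball
  -- A half-line beyond all thresholds in direction `i`, times small intervals free of thresholds: a
  -- box of infinite volume inside the cell of `y`.
  let I : Fin n → Set ℝ := fun j => if j = i then Set.Ici (y.coord i)
    else Metric.ball (y.coord j) (r j)
  have hIT : ∀ j, ∀ t ∈ T, t ∉ I j := fun j t ht => by
    by_cases hj : j = i
    · simpa [I, hj] using hi t ht
    · simpa only [I, hj, if_false] using hrT j t ht
  have hI : ∀ j, (I j).OrdConnected := fun j => by
    by_cases hj : j = i
    · simpa only [I, hj, if_true] using Set.ordConnected_Ici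
    · simpa only [I, hj, if_false] using (convex_ball (y.coord j) (r j)).ordConnected
  have hyI : ∀ j, y.coord j ∈ I j := fun j => by
    by_cases hj : j = i
    · simp [I, hj]
    · simpa only [I, hj, if_false] using Metric.mem_ball_self (hr j)
  have hvol : volume (Set.pi Set.univ I) = ∞ := by
    rw [volume_pi_pi]
    refine WithTop.prod_eq_top (Finset.mem_univ i) ?_ fun j _ => ?_
    · simp only [I, if_true]
      exact Real.volume_Ici
    · by_cases hj : j = i
      · simp only [I, hj, if_true, Real.volume_Ici]
        exact ENNReal.top_ne_zero
      · simp only [I, hj, if_false]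
        exact (Metric.measure_ball_pos volume _ (hr j)).ne'
  rw [eq_top_iff, ← hvol]
  -- The completion takes the same value as the original measure on every set.
  refine le_trans (le_of_eq (Measure.completion_apply _ _).symm) (measure_mono fun z hz => ?_)
  exact sameCell_of_ordConnected hI hIT hyI fun j => hz j (Set.mem_univ j)

theorem ae_forall_notMem (T : Finset ℝ) :
    ∀ᵐ x : LebesgueSpace n ∂lebesgueMeasure n, ∀ j, ParamSpace.coord x j ∉ T := by
  have h : ∀ᵐ x : Fin n → ℝ, ∀ j, ∀ t ∈ T, x j ≠ t := ae_all_iff.2 fun j =>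
    (ae_ball_iff T.countable_toSet).2 fun t _ =>
      Measure.ae_eval_ne (μ := fun _ : Fin n => (volume : Measure ℝ)) j t
  have h' : ∀ᵐ x : Fin n → ℝ, ∀ j, x j ∉ T := by
    filter_upwards [h] with x hx j hmem
    exact hx j _ hmem rfl
  exact h'

/-- A nonzero value beyond the last threshold would persist on a cell of infinite volume and make
the amplitude infinite. -/
theorem exists_forall_hilbertFunction_eq_zero (hp : 1 ≤ p) {K : CubMod F n} {T : Finset ℝ}
    (hT : ∀ (x y : ParamSpace n) (h : x ≤ y), SameCell T x y → IsIso (K.obj.map (homOfLE h)))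
    (hK : hilbertAmplitude (lebesgueMeasure n) p K ≠ ∞) (i : Fin n) :
    ∃ c : ℝ, ∀ y : ParamSpace n, (∀ j ≠ i, y.coord j ∉ T) → c < y.coord i →
      hilbertFunction K y = 0 := by
  obtain ⟨c, hc⟩ := T.bddAbove
  refine ⟨c, fun y hy hcy => ?_⟩
  by_contra h0
  have hi : ∀ t ∈ T, t < y.coord i := fun t ht => (hc ht).trans_lt hcy
  have hvol := volume_sameCell_eq_top (T := T) y (fun j => by
    by_cases hj : j = i
    · subst hj
      exact fun hm => lt_irrefl _ (hi _ hm)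
    · exact hy j hj) i hi
  refine hK (top_le_iff.1 (le_trans ?_ (le_hilbertAmplitude hp
    (U := {z | SameCell T y z}) fun z hz => ?_)))
  · rw [hvol, ENNReal.top_rpow_of_pos (by positivity)]
  · rwa [← hilbertFunction_eq_of_sameCell hT hz]

/-- The claim is that an element of `H⁰ B` of the form `f a` already comes from `H⁰ A`. Vanishing of
`ker f` far out on the rays from `x` turns the death of `f a` into the death of `a`. -/
theorem injective_cokernel_map_cubicalH0 (S : Finset (Fin n)) {A B : CubMod F n} (f : A ⟶ B)
    (x : ParamSpace n)
    (hx : ∀ i ∈ S, ∃ c : ℝ, ∀ y : ParamSpace n, (∀ j ≠ i, y.coord j = x.coord j) → c < y.coord i →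
      hilbertFunction (kernel f) y = 0) :
    Function.Injective ((cokernel.map ((cubicalH0 F S).map f) f _ _
      (cubicalH0_map_comp_inclusion S f)).hom.app x) := by
  rw [injective_iff_map_eq_zero]
  intro c hc
  obtain ⟨b, rfl⟩ := surjective_app_of_epi (cokernel.π ((cubicalH0 F S).map f)) x c
  rw [← comp_hom_app_apply, cokernel.π_desc, comp_hom_app_apply] at hc
  obtain ⟨a, ha⟩ := (exact_app_cokernel f x _).1 hc
  have ha' : a ∈ Set.range (((cubicalH0Inclusion F S).app A).hom.app x) := by
    refine (mem_range_cubicalH0Inclusion S A x a).2 fun i hi => ?_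
    obtain ⟨y, hxy, hy, h0⟩ := (mem_range_cubicalH0Inclusion S B x _).1 ⟨b, rfl⟩ i hi
    obtain ⟨c, hc⟩ := hx i hi
    -- At `y` the image of `b` has died but `ker f` may be nonzero; `z` lies further out on the ray,
    -- strictly beyond `c`, where both vanish.
    let z : ParamSpace n := fun j => if j = i then max (y.coord i) (c + 1) else y.coord j
    have hzi : z.coord i = max (y.coord i) (c + 1) := if_pos rfl
    have hzj : ∀ j ≠ i, z.coord j = y.coord j := fun j hj => if_neg hj
    have hyz : y ≤ z := fun j => by
      change y.coord j ≤ z.coord j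
      by_cases hj : j = i
      · rw [hj, hzi]
        exact le_max_left _ _
      · rw [hzj j hj]
    have hzx : ∀ j ≠ i, z.coord j = x.coord j := fun j hj =>
      (hzj j hj).trans (hy j (Finset.notMem_singleton.2 hj))
    have hker := (hilbertFunction_eq_zero_iff _ _).1 (hc z hzx (by
      rw [hzi]
      exact lt_max_of_lt_right (lt_add_one c)))
    refine ⟨z, hxy.trans hyz, fun j hj => hzx j (Finset.notMem_singleton.1 hj), ?_⟩
    have h1 : f.hom.app z (A.obj.map (homOfLE (hxy.trans hyz)) a) = 0 := by
      rw [NatTrans.naturality_apply, ha, ← map_map_apply B.obj hxy hyz]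
      exact (congrArg _ h0).trans (map_zero _)
    obtain ⟨k, hk⟩ := (exact_app_kernel f z _).1 h1
    rw [← hk, hker k, map_zero]
  obtain ⟨a', rfl⟩ := ha'
  have hb : b = ((cubicalH0 F S).map f).hom.app x a' := by
    refine injective_cubicalH0Inclusion S B x ?_
    rw [← comp_hom_app_apply, cubicalH0_map_comp_inclusion, comp_hom_app_apply]
    exact ha.symm
  rw [hb]
  exact (exact_app_cokernel _ x).apply_apply_eq_zero a'

theorem morphismCost_cubicalH0_map_le (hp : 1 ≤ p) (S : Finset (Fin n)) {A B : CubMod F n}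
    (f : A ⟶ B) :
    morphismCost (hilbertAmplitude (lebesgueMeasure n) p) ((cubicalH0 F S).map f) ≤
      morphismCost (hilbertAmplitude (lebesgueMeasure n) p) f := by
  by_cases hK : hilbertAmplitude (lebesgueMeasure n) p (kernel f) = ∞
  · simp [morphismCost, hK]
  refine add_le_add (hilbertAmplitude_mono hp (.of_forall fun x => ?_))
    (hilbertAmplitude_mono hp ?_)
  · let g := kernel.map ((cubicalH0 F S).map f) f _ _ (cubicalH0_map_comp_inclusion S f)
    have hg : g ≫ kernel.ι f = kernel.ι _ ≫ (cubicalH0Inclusion F S).app A := kernel.lift_ι _ _ _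
    have : Mono (kernel.ι ((cubicalH0 F S).map f) ≫ (cubicalH0Inclusion F S).app A) :=
      mono_comp _ _
    have : Mono g := mono_of_mono_fac hg
    exact hilbertFunction_le_of_injective g x (injective_app_of_mono g x)
  · obtain ⟨-, T, hT⟩ := GridConstant.of_cubicallyEncoded (kernel f).property
    filter_upwards [ae_forall_notMem T] with x hx
    refine hilbertFunction_le_of_injective _ x
      (injective_cokernel_map_cubicalH0 S f x fun i _ => ?_)
    obtain ⟨c, hc⟩ := exists_forall_hilbertFunction_eq_zero hp hT hK i
    exact ⟨c, fun y hy => hc y fun j hj => by rw [hy j hj]; exact hx j⟩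

theorem isLipschitzFor_pathDist_cubicalH0 (hp : 1 ≤ p) (S : Finset (Fin n)) :
    IsLipschitzFor (pathDist (hilbertAmplitude (F := F) (lebesgueMeasure n) p))
      (pathDist (hilbertAmplitude (lebesgueMeasure n) p)) 1 (cubicalH0 F S).obj := by
  intro A B
  rw [ENNReal.coe_one, one_mul]
  exact pathDist_map_le _ (morphismCost_cubicalH0_map_le hp S) A B

end Lebesgue

/-! ### Discontinuity for finite measures -/

section Discontinuity

variable (F : Type u) [Field F] {n : ℕ}

/-- The cyclic persistence module whose value at `x` is the quotient of `F` by `I x`. -/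
noncomputable def cyclicModule (I : ParamSpace n →o Submodule F F) : PersMod F n where
  obj x := ModuleCat.of F (F ⧸ I x)
  map f := ModuleCat.ofHom (Submodule.factor (I.monotone (leOfHom f)))
  map_id _ := ModuleCat.hom_ext (Submodule.linearMap_qext _ rfl)
  map_comp _ _ := ModuleCat.hom_ext (Submodule.linearMap_qext _ rfl)

variable {F}

theorem injective_factor_of_le {p q : Submodule F F} (h : p ≤ q) (h' : q ≤ p) :
    Function.Injective (Submodule.factor h) :=
  Function.LeftInverse.injective (g := Submodule.factor h') fun a => by
    induction a using Submodule.Quotient.induction_on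
    rfl

theorem gridConstant_cyclicModule (I : ParamSpace n →o Submodule F F) (T : Finset ℝ)
    (hT : ∀ x y, SameCell T x y → I x = I y) : GridConstant (cyclicModule F I) := by
  refine ⟨fun x => inferInstanceAs (FiniteDimensional F (F ⧸ I x)), T, fun x y hxy hc => ?_⟩
  rw [ConcreteCategory.isIso_iff_bijective]
  exact ⟨injective_factor_of_le (I.monotone hxy) (hT x y hc).ge, Submodule.factor_surjective (I.monotone hxy)⟩

variable (F n) in
/-- The persistence module with constant value `F`. -/
noncomputable def constantModule : CubMod F n :=
  ⟨cyclicModule F ⊥, (gridConstant_cyclicModule ⊥ ∅ fun _ _ _ => rfl).cubicallyEncoded⟩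

/-- The points of `ℝⁿ` all of whose coordinates are less than `k`. -/
def lowerOrthant (n : ℕ) (k : ℝ) : Set (ParamSpace n) := {x | ∀ i, x.coord i < k}

variable (F) in
open Classical in
/-- The submodules of `F` that vanish exactly on an orthant. -/
noncomputable def orthantRelations (k : ℝ) : ParamSpace n →o Submodule F F where
  toFun x := if x ∈ lowerOrthant n k then ⊥ else ⊤
  monotone' x y h := by
    by_cases hy : y ∈ lowerOrthant n k
    · have hx : x ∈ lowerOrthant n k := fun i => (h i).trans_lt (hy i)
      exact (if_pos hx).le.trans bot_le
    · exact le_top.trans (if_neg hy).ge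

theorem orthantRelations_of_mem {k : ℝ} {x : ParamSpace n} (hx : x ∈ lowerOrthant n k) :
    orthantRelations F k x = ⊥ := if_pos hx

theorem orthantRelations_of_notMem {k : ℝ} {x : ParamSpace n} (hx : x ∉ lowerOrthant n k) :
    orthantRelations F k x = ⊤ := if_neg hx

variable (F n) in
/-- The persistence module with value `F` on an orthant and `0` elsewhere. -/
noncomputable def orthantModule (k : ℝ) : CubMod F n :=
  ⟨cyclicModule F (orthantRelations F k), (gridConstant_cyclicModule _ {k} fun x y h => by
    have : x ∈ lowerOrthant n k ↔ y ∈ lowerOrthant n k :=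
      forall_congr' fun i => (h i k (Finset.mem_singleton_self k)).1
    by_cases hx : x ∈ lowerOrthant n k
    · rw [orthantRelations_of_mem hx, orthantRelations_of_mem (this.1 hx)]
    · rw [orthantRelations_of_notMem hx,
        orthantRelations_of_notMem fun hy => hx (this.2 hy)]).cubicallyEncoded⟩

variable (F n) in
/-- The projection from the constant module to the orthant module. -/
noncomputable def orthantProjection (k : ℝ) : constantModule F n ⟶ orthantModule F n k :=
  ObjectProperty.homMk
    { app := fun x => ModuleCat.ofHom
        (Submodule.factor (bot_le : (⊥ : Submodule F F) ≤ orthantRelations F k x))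
      naturality := fun _ _ _ => ModuleCat.hom_ext (Submodule.linearMap_qext _ rfl) }

theorem eq_zero_of_notMem_lowerOrthant {k : ℝ} {x : ParamSpace n} (hx : x ∉ lowerOrthant n k)
    (a : (orthantModule F n k).obj.obj x) : a = 0 := by
  have : Subsingleton (F ⧸ orthantRelations F k x) :=
    Submodule.Quotient.subsingleton_iff.2 (orthantRelations_of_notMem hx)
  exact Subsingleton.elim (α := F ⧸ orthantRelations F k x) a 0

theorem hilbertFunction_constantModule (x : ParamSpace n) :
    hilbertFunction (constantModule F n) x = 1 := by
  have h : Module.finrank F (F ⧸ (⊥ : Submodule F F)) = 1 := by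
    rw [(Submodule.quotEquivOfEqBot ⊥ rfl).finrank_eq, Module.finrank_self]
  exact (congrArg Nat.cast h).trans Nat.cast_one

theorem hilbertFunction_kernel_orthantProjection_le (k : ℝ) (x : ParamSpace n) :
    hilbertFunction (kernel (orthantProjection F n k)) x ≤
      Set.indicator (M := ℝ≥0∞) (lowerOrthant n k)ᶜ 1 x := by
  by_cases hx : x ∈ lowerOrthant n k
  · rw [hilbertFunction_kernel_eq_zero _ x
      (injective_factor_of_le bot_le (orthantRelations_of_mem hx).le)]
    exact zero_le
  · rw [Set.indicator_of_mem (show x ∈ (lowerOrthant n k)ᶜ from hx)]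
    exact (hilbertFunction_le_of_injective (kernel.ι _) x (injective_app_of_mono _ x)).trans
      (hilbertFunction_constantModule x).le

/-- The structure maps are injective, so no nonzero element dies in any direction. One direction is
needed, hence the nonempty `S`. -/
theorem hilbertFunction_cubicalH0_constantModule {S : Finset (Fin n)} (hS : S.Nonempty)
    (x : ParamSpace n) : hilbertFunction ((cubicalH0 F S).obj (constantModule F n)) x = 0 := by
  refine (hilbertFunction_eq_zero_iff _ _).2 fun m => ?_
  obtain ⟨i, hi⟩ := hS
  obtain ⟨y, hxy, -, h⟩ := (mem_range_cubicalH0Inclusion S _ x _).1 ⟨m, rfl⟩ i hi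
  refine injective_cubicalH0Inclusion S _ x ?_
  refine injective_factor_of_le (le_refl (⊥ : Submodule F F)) le_rfl ?_
  exact h.trans (by rw [map_zero]; exact (map_zero _).symm)

theorem hilbertFunction_cubicalH0_orthantModule_ne_zero (S : Finset (Fin n)) {k : ℝ}
    {x : ParamSpace n} (hx : x ∈ lowerOrthant n k) :
    hilbertFunction ((cubicalH0 F S).obj (orthantModule F n k)) x ≠ 0 := by
  intro h0
  rw [hilbertFunction_eq_zero_iff] at h0
  have hone : ∀ m : (orthantModule F n k).obj.obj x, m = 0 := fun m => by
    obtain ⟨l, rfl⟩ := (mem_range_cubicalH0Inclusion S (orthantModule F n k) x m).2 fun i _ => by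
      -- The orthant is open, so raising coordinate `i` to `k` exactly already leaves it, and the
      -- module is zero there.
      let y : ParamSpace n := fun j => if j = i then k else x.coord j
      have hyi : y.coord i = k := if_pos rfl
      have hyj : ∀ j ≠ i, y.coord j = x.coord j := fun j hj => if_neg hj
      refine ⟨y, fun j => ?_, fun j hj => hyj j (Finset.notMem_singleton.1 hj),
        eq_zero_of_notMem_lowerOrthant (fun hy => ?_) _⟩
      · change x.coord j ≤ y.coord j
        by_cases hj : j = i
        · rw [hj, hyi]
          exact (hx i).le
        · rw [hyj j hj]
      · exact (hy i).ne hyi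
    rw [h0 l, map_zero]
  have h1 : (Submodule.Quotient.mk 1 : F ⧸ orthantRelations F k x) = 0 := hone _
  rw [Submodule.Quotient.mk_eq_zero, orthantRelations_of_mem hx] at h1
  exact one_ne_zero ((Submodule.mem_bot F).1 h1)

variable {μ : Measure (LebesgueSpace n)} {p : ℝ}

theorem pathDist_constantModule_orthantModule_le (hp : 1 ≤ p) (k : ℝ) :
    pathDist (hilbertAmplitude μ p) (constantModule F n) (orthantModule F n k) ≤
      μ (lowerOrthant n k)ᶜ ^ (1 / p) := by
  refine (pathDist_le_of_hom (orthantProjection F n k)).trans ?_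
  have h1 : hilbertAmplitude μ p (kernel (𝟙 (constantModule F n))) = 0 :=
    hilbertAmplitude_eq_zero hp fun x =>
      hilbertFunction_kernel_eq_zero _ x (injective_app_of_mono _ x)
  have h2 : hilbertAmplitude μ p (cokernel (𝟙 (constantModule F n))) = 0 :=
    hilbertAmplitude_eq_zero hp fun x =>
      hilbertFunction_cokernel_eq_zero _ x (surjective_app_of_epi _ x)
  have h3 : hilbertAmplitude μ p (cokernel (orthantProjection F n k)) = 0 :=
    hilbertAmplitude_eq_zero hp fun x =>
      hilbertFunction_cokernel_eq_zero _ x (Submodule.factor_surjective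
        (bot_le : (⊥ : Submodule F F) ≤ orthantRelations F k x))
  rw [morphismCost, morphismCost, h1, h2, h3, zero_add, zero_add, add_zero]
  exact hilbertAmplitude_le_of_le_indicator hp (hilbertFunction_kernel_orthantProjection_le k)

/-- Continuity from above for a decreasing sequence with empty intersection; this is where
finiteness of the measure matters. -/
theorem tendsto_measure_lowerOrthant_compl [IsFiniteMeasure μ] :
    Filter.Tendsto (fun k : ℕ => μ (lowerOrthant n k)ᶜ) Filter.atTop (nhds 0) := by
  let U : ℕ → Set (LebesgueSpace n) := fun k => lowerOrthant n k
  have hmeas : ∀ k, MeasurableSet (U k) := fun k =>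
    (IsCubical.measurableSet ⟨{lowerOrthant n (k : ℝ)}, Set.finite_singleton _, by
      rintro _ rfl
      exact ⟨fun _ => Set.Iio (k : ℝ), fun _ => Set.ordConnected_Iio, rfl⟩,
      (Set.sUnion_singleton _).symm⟩).nullMeasurableSet
  have hempty : ⋂ k : ℕ, (U k)ᶜ = ∅ := by
    rw [← Set.compl_iUnion, Set.compl_empty_iff, Set.eq_univ_iff_forall]
    intro x
    obtain ⟨k, hk⟩ := exists_nat_gt (∑ i, |ParamSpace.coord x i|)
    refine Set.mem_iUnion.2 ⟨k, fun i => ((le_abs_self _).trans ?_).trans_lt hk⟩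
    exact Finset.single_le_sum (f := fun i => |ParamSpace.coord x i|) (fun i _ => abs_nonneg _)
      (Finset.mem_univ i)
  have := tendsto_measure_iInter_atTop (μ := μ) (s := fun k : ℕ => (U k)ᶜ)
    (fun k => (hmeas k).compl.nullMeasurableSet)
    (fun k l hkl => Set.compl_subset_compl.2 fun x hx i =>
      (hx i).trans_le (Nat.cast_le.2 hkl)) ⟨0, measure_ne_top _ _⟩
  rwa [hempty, measure_empty] at this

theorem not_isContinuousFor_cubicalH0 [IsFiniteMeasure μ] (hμ : μ ≠ 0) (hp : 1 ≤ p)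
    {S : Finset (Fin n)} (hS : S.Nonempty) :
    ¬ IsContinuousFor (pathDist (hilbertAmplitude (F := F) μ p))
      (pathDist (hilbertAmplitude μ p)) (cubicalH0 F S).obj := by
  intro h
  have hp0 : 0 < 1 / p := by positivity
  have hhalf : 0 < μ Set.univ / 2 := ENNReal.half_pos (Measure.measure_univ_ne_zero.2 hμ)
  -- Once the complement of the orthant has less than half the total mass, the orthant has at least
  -- half, so this tolerance bounds from below the distance between the two `H⁰`.
  obtain ⟨δ, hδ, H⟩ := h (constantModule F n) ((μ Set.univ / 2) ^ (1 / p))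
    (ENNReal.rpow_pos_of_nonneg hhalf hp0.le)
  have hlim := tendsto_measure_lowerOrthant_compl (μ := μ)
  have hlim' : Filter.Tendsto (fun k : ℕ => μ (lowerOrthant n k)ᶜ ^ (1 / p)) Filter.atTop
      (nhds 0) := by
    have := ((ENNReal.continuous_rpow_const (y := 1 / p)).tendsto 0).comp hlim
    rwa [ENNReal.zero_rpow_of_pos hp0] at this
  obtain ⟨k, hk1, hk2⟩ := ((hlim.eventually (gt_mem_nhds hhalf)).and
    (hlim'.eventually (gt_mem_nhds hδ))).exists
  refine (H _ ((pathDist_constantModule_orthantModule_le hp k).trans_lt hk2)).not_ge ?_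
  have hbig : μ Set.univ / 2 ≤ μ (lowerOrthant n k) := by
    have h1 : μ Set.univ / 2 + μ Set.univ / 2 ≤ μ (lowerOrthant n k) + μ Set.univ / 2 := by
      rw [ENNReal.add_halves]
      exact (measure_univ_le_add_compl (μ := μ) _).trans (add_le_add le_rfl hk1.le)
    exact (ENNReal.add_le_add_iff_right
      (ENNReal.div_ne_top (measure_ne_top _ _) two_ne_zero)).1 h1
  have h0 : hilbertAmplitude μ p ((cubicalH0 F S).obj (constantModule F n)) = 0 :=
    hilbertAmplitude_eq_zero hp (hilbertFunction_cubicalH0_constantModule hS)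
  calc (μ Set.univ / 2) ^ (1 / p) ≤ μ (lowerOrthant n k) ^ (1 / p) :=
        ENNReal.rpow_le_rpow hbig hp0.le
    _ ≤ hilbertAmplitude μ p ((cubicalH0 F S).obj (orthantModule F n k)) :=
        le_hilbertAmplitude hp fun x hx => hilbertFunction_cubicalH0_orthantModule_ne_zero S hx
    _ ≤ _ := (hilbertAmplitude_le_add_pathDist hp _ _).trans_eq (by rw [h0, zero_add])

end Discontinuity

theorem mainTheorem9 (F : Type u) [Field F] {n : ℕ} (S : Finset (Fin n)) (hS : S.Nonempty) :
    (∀ α : CubMod F n → ℝ≥0∞, IsAmplitude α → IsAmplitudeBounding α α 1 (cubicalH0 F S)) ∧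
    (∀ (v : ParamSpace n) (hv : 0 ≤ v),
      IsLipschitzFor (interleavingDist hv) (interleavingDist hv) 1 (cubicalH0 F S).obj) ∧
    (∀ μ : Measure (LebesgueSpace n), IsFiniteMeasure μ → μ ≠ 0 → ∀ p : ℝ, 1 ≤ p →
      ¬ IsContinuousFor (pathDist (hilbertAmplitude μ p)) (pathDist (hilbertAmplitude μ p))
        (cubicalH0 F S).obj) ∧
    (∀ p : ℝ, 1 ≤ p →
      IsLipschitzFor (pathDist (hilbertAmplitude (lebesgueMeasure n) p))
        (pathDist (hilbertAmplitude (lebesgueMeasure n) p)) 1 (cubicalH0 F S).obj) :=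
  ⟨fun _ hα => isAmplitudeBounding_cubicalH0 S hα,
    fun _ hv => isLipschitzFor_interleavingDist_cubicalH0 S hv,
    fun _ _ hμ _ hp => not_isContinuousFor_cubicalH0 hμ hp hS,
    fun _ hp => isLipschitzFor_pathDist_cubicalH0 hp S⟩
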